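/- Let $r\ge 1$, $m,n,l$ be integers, let $x^{(1)},\dots,x^{(l)}\in\mathbb R^n$ and $y^{(1)},\dots,y^{(l)}\in\mathbb R^m$ (Euclidean norms), let $\beta\ge 0$ and $s\in\mathbb R$, and let $t\in(0,1)$. Let $\mathbf m=(\mathbf m_0,\dots,\mathbf m_{r+1})$ be real numbers with $\mathbf m_0=1$, $\mathbf m_{r+1}=0$ and $\mathbf m_k\neq 0$ for $1\le k\le r$, and let $1\ge p_0\ge p_1\ge\dots\ge p_r\ge p_{r+1}=0$ and $1\ge q_0\ge q_1\ge\dots\ge q_r\ge q_{r+1}=0$. Let all components of $G\in\mathbb R^{m\times n}$ and, for $1\le k\le r+1$, of $u^{(4,k)}\in\mathbb R$, $u^{(2,k)}\in\mathbb R^m$, $h^{(k)}\in\mathbb R^n$ be independent centered normal variables with variances $1$, $p_{k-1}q_{k-1}-p_kq_k$, $p_{k-1}-p_k$ and $q_{k-1}-q_k$, respectively. Put $\mathcal U_k=[u^{(4,k)},u^{(2,k)},h^{(k)}]$, and let $\mathbb E_{\mathcal U_k}$ be the expectation over $\mathcal U_k$ only. Let $$D_0^{(i_1,i_2)}=\sqrt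 t\,(y^{(i_2)})^TGx^{(i_1)}+\sqrt{1-t}\,\|x^{(i_1)}\|(y^{(i_2)})^T\sum_{k=1}^{r+1}u^{(2,k)}+\sqrt t\,\|x^{(i_1)}\|\|y^{(i_2)}\|\sum_{k=1}^{r+1}u^{(4,k)}+\sqrt{1-t}\,\|y^{(i_2)}\|\Big(\sum_{k=1}^{r+1}h^{(k)}\Big)^Tx^{(i_1)},$$ $A^{(i_1,i_2)}=e^{\beta D_0^{(i_1,i_2)}}$, $C^{(i_1)}=\sum_{i_2=1}^lA^{(i_1,i_2)}$, $Z=\sum_{i_1=1}^l(C^{(i_1)})^s$, and $\zeta_0=Z$, $\zeta_k=\mathbb E_{\mathcal U_k}\zeta_{k-1}^{\mathbf m_k/\mathbf m_{k-1}}$ for $1\le k\le r$. Consider $$\psi(t)=\mathbb E_{G,\mathcal U_{r+1}}\frac{1}{\beta|s|\sqrt n\,\mathbf m_r}\log\zeta_r$$ (in the degenerate case $\beta|s|\sqrt n=0$, division by zero is read as giving $0$, so that both sides below are $0$). For $1\le k\le r$ let $\Phi_{\mathcal U_k}(F)=\mathbb E_{\mathcal U_k}\big(\zeta_{k-1}^{\mathbf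 m_k/\mathbf m_{k-1}}\zeta_k^{-1}F\big)$, write $\prod_{v=b}^{a}\Phi_{\mathcal U_v}=\Phi_{\mathcal U_b}\Phi_{\mathcal U_{b-1}}\cdots\Phi_{\mathcal U_a}$ (the identity if $b<a$), and let $$\gamma_0(i_1,i_2)=\frac{(C^{(i_1)})^s}{Z}\frac{A^{(i_1,i_2)}}{C^{(i_1)}},\qquad \gamma_{01}^{(r)}(i_1,i_2)=\prod_{v=r}^{1}\Phi_{\mathcal U_v}\gamma_0(i_1,i_2),\qquad \gamma_{02}^{(r)}(i_1,i_2,p_2)=\prod_{v=r}^{1}\Phi_{\mathcal U_v}\Big(\frac{(C^{(i_1)})^s}{Z}\frac{A^{(i_1,i_2)}A^{(i_1,p_2)}}{(C^{(i_1)})^2}\Big),$$ $$\gamma_k^{(r)}(i_1,i_2,p_1,p_2)=\prod_{v=r}^{k}\Phi_{\mathcal U_v}\Big(\prod_{v=k-1}^{1}\Phi_{\mathcal U_v}\gamma_0(i_1,i_2)\cdot\prod_{v=k-1}^{1}\Phi_{\mathcal U_v}\gamma_0(p_1,p_2)\Big),\qquad 1\le k\le r+1.$$ With $\langle\cdot\rangle_\gamma$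 the sum over all indices weighted by $\gamma$, let, for $1\le k\le r+1$, $$\phi_k^{(r)}=-s(\mathbf m_{k-1}-\mathbf m_k)\,\mathbb E_{G,\mathcal U_{r+1}}\Big\langle\big(p_{k-1}\|x^{(i_1)}\|\|x^{(p_1)}\|-(x^{(p_1)})^Tx^{(i_1)}\big)\big(q_{k-1}\|y^{(i_2)}\|\|y^{(p_2)}\|-(y^{(p_2)})^Ty^{(i_2)}\big)\Big\rangle_{\gamma_k^{(r)}},$$ $$\phi_{01}^{(r)}=(1-p_0)(1-q_0)\,\mathbb E_{G,\mathcal U_{r+1}}\big\langle\|x^{(i_1)}\|^2\|y^{(i_2)}\|^2\big\rangle_{\gamma_{01}^{(r)}},$$ $$\phi_{02}^{(r)}=-(s-1)(1-p_0)\,\mathbb E_{G,\mathcal U_{r+1}}\Big\langle\|x^{(i_1)}\|^2\big(q_0\|y^{(i_2)}\|\|y^{(p_2)}\|-(y^{(p_2)})^Ty^{(i_2)}\big)\Big\rangle_{\gamma_{02}^{(r)}}.$$ Then $\psi$ is differentiable at $t$ and $$\frac{d\psi}{dt}(t)=\frac{\operatorname{sign}(s)\,\beta}{2\sqrt n}\Big(\sum_{k=1}^{r+1}\phi_k^{(r)}+\phi_{01}^{(r)}+\phi_{02}^{(r)}\Big).$$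 In particular, if $p_0=q_0=1$, then $\frac{d\psi}{dt}(t)=\frac{\operatorname{sign}(s)\,\beta}{2\sqrt n}\sum_{k=1}^{r+1}\phi_k^{(r)}$. -/

import Mathlib

namespace FullLifting

open MeasureTheory ProbabilityTheory

noncomputable section

/-- One Gaussian layer `𝒰 = [u⁽⁴⁾, u⁽²⁾, h]` with `u⁽⁴⁾ ∈ ℝ`, `u⁽²⁾ ∈ ℝ^m`, `h ∈ ℝ^n`. -/
abbrev Layer (m n : ℕ) : Type := ℝ × (Fin m → ℝ) × (Fin n → ℝ)

/-- A realization of all the randomness: the `m × n` matrix `G` and the layers `𝒰_k`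
(only the layers with `1 ≤ k ≤ r + 1` are ever used). -/
abbrev Sample (m n : ℕ) : Type := (Fin m → Fin n → ℝ) × (ℕ → Layer m n)

/-- Law of a vector in `ℝ^d` with i.i.d. centered normal components of variance `v`. -/
def gaussVec (d : ℕ) (v : ℝ) : Measure (Fin d → ℝ) :=
  Measure.pi fun _ => gaussianReal 0 v.toNNReal

/-- Law of `G`: i.i.d. standard normal entries. -/
def matLaw (m n : ℕ) : Measure (Fin m → Fin n → ℝ) :=
  Measure.pi fun _ => Measure.pi fun _ => gaussianReal 0 1

/-- Law of the layer `𝒰_k`, `k ≥ 1`: independent centered normal components with variances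
`p_{k-1} q_{k-1} - p_k q_k`, `p_{k-1} - p_k` and `q_{k-1} - q_k`. -/
def layerLaw (m n : ℕ) (p q : ℕ → ℝ) (k : ℕ) : Measure (Layer m n) :=
  (gaussianReal 0 (p (k - 1) * q (k - 1) - p k * q k).toNNReal).prod
    ((gaussVec m (p (k - 1) - p k)).prod (gaussVec n (q (k - 1) - q k)))

section

variable {m n l : ℕ}

/-- The partial expectation `𝔼_{𝒰_k} F`: average over the layer `k`, all the other
randomness being kept fixed. -/
def layerExp (p q : ℕ → ℝ) (k : ℕ) (F : Sample m n → ℝ) (ω : Sample m n) : ℝ :=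
  ∫ u, F (ω.1, Function.update ω.2 k u) ∂(layerLaw m n p q k)

/-- The expectation `𝔼_{G, 𝒰_{r+1}} F`. It is applied only to `F` that have already been averaged
over the layers `1, …, r`, so the value `0` given to these layers is immaterial. -/
def outerExp (p q : ℕ → ℝ) (r : ℕ) (F : Sample m n → ℝ) : ℝ :=
  ∫ z, F (z.1, Function.update 0 (r + 1) z.2) ∂((matLaw m n).prod (layerLaw m n p q (r + 1)))

/-- The bilinearly indexed process `D_0^{(i₁,i₂)}`. -/
def D₀ (r : ℕ) (x : Fin l → EuclideanSpace ℝ (Fin n)) (y : Fin l → EuclideanSpace ℝ (Fin m))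
    (t : ℝ) (i₁ i₂ : Fin l) (ω : Sample m n) : ℝ :=
  √t * (∑ a, ∑ b, y i₂ a * ω.1 a b * x i₁ b)
    + √(1 - t) * ‖x i₁‖ * (∑ a, y i₂ a * ∑ k ∈ Finset.Icc 1 (r + 1), (ω.2 k).2.1 a)
    + √t * ‖x i₁‖ * ‖y i₂‖ * (∑ k ∈ Finset.Icc 1 (r + 1), (ω.2 k).1)
    + √(1 - t) * ‖y i₂‖ * (∑ b, (∑ k ∈ Finset.Icc 1 (r + 1), (ω.2 k).2.2 b) * x i₁ b)

/-- `A^{(i₁,i₂)} = exp(β D_0^{(i₁,i₂)})`. -/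
def A (r : ℕ) (x : Fin l → EuclideanSpace ℝ (Fin n)) (y : Fin l → EuclideanSpace ℝ (Fin m))
    (β t : ℝ) (i₁ i₂ : Fin l) (ω : Sample m n) : ℝ :=
  Real.exp (β * D₀ r x y t i₁ i₂ ω)

/-- `C^{(i₁)} = ∑_{i₂} A^{(i₁,i₂)}`. -/
def C (r : ℕ) (x : Fin l → EuclideanSpace ℝ (Fin n)) (y : Fin l → EuclideanSpace ℝ (Fin m))
    (β t : ℝ) (i₁ : Fin l) (ω : Sample m n) : ℝ :=
  ∑ i₂, A r x y β t i₁ i₂ ω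

/-- `Z = ∑_{i₁} (C^{(i₁)})^s`. -/
def Z (r : ℕ) (x : Fin l → EuclideanSpace ℝ (Fin n)) (y : Fin l → EuclideanSpace ℝ (Fin m))
    (β s t : ℝ) (ω : Sample m n) : ℝ :=
  ∑ i₁, C r x y β t i₁ ω ^ s

/-- `ζ_0 = Z` and `ζ_k = 𝔼_{𝒰_k} ζ_{k-1}^{c_k / c_{k-1}}`; `c` is the vector of exponents. -/
def ζ (r : ℕ) (x : Fin l → EuclideanSpace ℝ (Fin n)) (y : Fin l → EuclideanSpace ℝ (Fin m))
    (p q c : ℕ → ℝ) (β s t : ℝ) : ℕ → Sample m n → ℝ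
  | 0 => Z r x y β s t
  | k + 1 => layerExp p q (k + 1) fun ω => ζ r x y p q c β s t k ω ^ (c (k + 1) / c k)

/-- The interpolating function `ψ(t) = 𝔼_{G, 𝒰_{r+1}} (β |s| √n c_r)⁻¹ log ζ_r`. -/
def ψ (r : ℕ) (x : Fin l → EuclideanSpace ℝ (Fin n)) (y : Fin l → EuclideanSpace ℝ (Fin m))
    (p q c : ℕ → ℝ) (β s t : ℝ) : ℝ :=
  outerExp p q r fun ω => 1 / (β * |s| * √n * c r) * Real.log (ζ r x y p q c β s t r ω)

/-- The operator `Φ_{𝒰_k} F = 𝔼_{𝒰_k} (ζ_{k-1}^{c_k / c_{k-1}} / ζ_k · F)`, `k ≥ 1`. -/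
def Φ (r : ℕ) (x : Fin l → EuclideanSpace ℝ (Fin n)) (y : Fin l → EuclideanSpace ℝ (Fin m))
    (p q c : ℕ → ℝ) (β s t : ℝ) (k : ℕ) (F : Sample m n → ℝ) : Sample m n → ℝ :=
  layerExp p q k fun ω =>
    ζ r x y p q c β s t (k - 1) ω ^ (c k / c (k - 1)) / ζ r x y p q c β s t k ω * F ω

/-- The composition `Φ_{𝒰_b} Φ_{𝒰_{b-1}} ⋯ Φ_{𝒰_a}`, the identity when `b < a`. -/
def Φchain (r : ℕ) (x : Fin l → EuclideanSpace ℝ (Fin n)) (y : Fin l → EuclideanSpace ℝ (Fin m))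
    (p q c : ℕ → ℝ) (β s t : ℝ) (a : ℕ) : ℕ → (Sample m n → ℝ) → Sample m n → ℝ
  | 0, F => F
  | b + 1, F =>
    if a ≤ b + 1 then Φ r x y p q c β s t (b + 1) (Φchain r x y p q c β s t a b F) else F

/-- The Gibbs weight `γ_0(i₁,i₂) = (C^{(i₁)})^s / Z · A^{(i₁,i₂)} / C^{(i₁)}`. -/
def γ₀ (r : ℕ) (x : Fin l → EuclideanSpace ℝ (Fin n)) (y : Fin l → EuclideanSpace ℝ (Fin m))
    (β s t : ℝ) (i₁ i₂ : Fin l) (ω : Sample m n) : ℝ :=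
  C r x y β t i₁ ω ^ s / Z r x y β s t ω * (A r x y β t i₁ i₂ ω / C r x y β t i₁ ω)

/-- `γ_{01}(i₁,i₂) = Φ_{𝒰_r} ⋯ Φ_{𝒰_1} γ_0(i₁,i₂)`. -/
def γ₀₁ (r : ℕ) (x : Fin l → EuclideanSpace ℝ (Fin n)) (y : Fin l → EuclideanSpace ℝ (Fin m))
    (p q c : ℕ → ℝ) (β s t : ℝ) (i₁ i₂ : Fin l) : Sample m n → ℝ :=
  Φchain r x y p q c β s t 1 r (γ₀ r x y β s t i₁ i₂)

/-- `γ_{02}(i₁,i₂,p₂) = Φ_{𝒰_r} ⋯ Φ_{𝒰_1} ((C^{(i₁)})^s / Z · A^{(i₁,i₂)} / C^{(i₁)} ·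
A^{(i₁,p₂)} / C^{(i₁)})`: one draw of the first index, two conditionally independent draws of the
second one. -/
def γ₀₂ (r : ℕ) (x : Fin l → EuclideanSpace ℝ (Fin n)) (y : Fin l → EuclideanSpace ℝ (Fin m))
    (p q c : ℕ → ℝ) (β s t : ℝ) (i₁ i₂ p₂ : Fin l) : Sample m n → ℝ :=
  Φchain r x y p q c β s t 1 r fun ω =>
    C r x y β t i₁ ω ^ s / Z r x y β s t ω
      * (A r x y β t i₁ i₂ ω / C r x y β t i₁ ω) * (A r x y β t i₁ p₂ ω / C r x y β t i₁ ω)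

/-- For `1 ≤ k ≤ r + 1`, the weight `γ_k(i₁,i₂,p₁,p₂) = Φ_{𝒰_r} ⋯ Φ_{𝒰_k}
((Φ_{𝒰_{k-1}} ⋯ Φ_{𝒰_1} γ_0(i₁,i₂)) (Φ_{𝒰_{k-1}} ⋯ Φ_{𝒰_1} γ_0(p₁,p₂)))`. -/
def γ (r : ℕ) (x : Fin l → EuclideanSpace ℝ (Fin n)) (y : Fin l → EuclideanSpace ℝ (Fin m))
    (p q c : ℕ → ℝ) (β s t : ℝ) (k : ℕ) (i₁ i₂ p₁ p₂ : Fin l) : Sample m n → ℝ :=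
  Φchain r x y p q c β s t k r fun ω =>
    Φchain r x y p q c β s t 1 (k - 1) (γ₀ r x y β s t i₁ i₂) ω
      * Φchain r x y p q c β s t 1 (k - 1) (γ₀ r x y β s t p₁ p₂) ω

/-- `φ_k = -s (c_{k-1} - c_k) 𝔼_{G, 𝒰_{r+1}} ⟨(p_{k-1} ‖x‖ ‖x'‖ - x'ᵀx) (q_{k-1} ‖y‖ ‖y'‖ - y'ᵀy)⟩`,
the average `⟨·⟩` being with respect to `γ_k`. -/
def φ (r : ℕ) (x : Fin l → EuclideanSpace ℝ (Fin n)) (y : Fin l → EuclideanSpace ℝ (Fin m))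
    (p q c : ℕ → ℝ) (β s t : ℝ) (k : ℕ) : ℝ :=
  -s * (c (k - 1) - c k) * outerExp p q r fun ω =>
    ∑ i₁, ∑ i₂, ∑ p₁, ∑ p₂,
      (p (k - 1) * (‖x i₁‖ * ‖x p₁‖) - inner ℝ (x p₁) (x i₁))
        * (q (k - 1) * (‖y i₂‖ * ‖y p₂‖) - inner ℝ (y p₂) (y i₂))
        * γ r x y p q c β s t k i₁ i₂ p₁ p₂ ω

/-- `φ_{01} = (1 - p_0) (1 - q_0) 𝔼_{G, 𝒰_{r+1}} ⟨‖x‖² ‖y‖²⟩`, averaged over `γ_{01}`. -/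
def φ₀₁ (r : ℕ) (x : Fin l → EuclideanSpace ℝ (Fin n)) (y : Fin l → EuclideanSpace ℝ (Fin m))
    (p q c : ℕ → ℝ) (β s t : ℝ) : ℝ :=
  (1 - p 0) * (1 - q 0) * outerExp p q r fun ω =>
    ∑ i₁, ∑ i₂, ‖x i₁‖ ^ 2 * ‖y i₂‖ ^ 2 * γ₀₁ r x y p q c β s t i₁ i₂ ω

/-- `φ_{02} = -(s - 1) (1 - p_0) 𝔼_{G, 𝒰_{r+1}} ⟨‖x‖² (q_0 ‖y‖ ‖y'‖ - y'ᵀy)⟩`, averaged over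
`γ_{02}`. -/
def φ₀₂ (r : ℕ) (x : Fin l → EuclideanSpace ℝ (Fin n)) (y : Fin l → EuclideanSpace ℝ (Fin m))
    (p q c : ℕ → ℝ) (β s t : ℝ) : ℝ :=
  -(s - 1) * (1 - p 0) * outerExp p q r fun ω =>
    ∑ i₁, ∑ i₂, ∑ p₂,
      ‖x i₁‖ ^ 2 * (q 0 * (‖y i₂‖ * ‖y p₂‖) - inner ℝ (y p₂) (y i₂))
        * γ₀₂ r x y p q c β s t i₁ i₂ p₂ ω

end

end

end FullLifting

/-!
Seen through the values of `D₀`, everything is a function of a Gaussian field on the index set, each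
layer of which is a fixed Gaussian vector with time dependent coefficients, and `ζ` arises from `Z`
by the steps `W ↦ 𝔼 W ^ (c (k + 1) / c k)`.

Normalize the derivatives of `W` as `∂ₜ W = c W h`, `∇ W = c W D` and `∇² W = c W Q`. Raising `W` to
the power `c' / c` keeps `h` and `D` and adds `(c' - c) D ⊗ D` to `Q`. Averaging `W` over a layer
replaces `h`, `D` and `Q` by their means under the law tilted by `W` and, by Gaussian integration by
parts, adds to `h` half the time derivative of the covariance of that layer, applied to `Q`.

Let `K k` be half the time derivative of the covariance of `G` and of the layers above `k`.
Averaging over the layer `k + 1` lowers `K k` to `K (k + 1)`, so that `h + K k Q` is transported by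
the averaging, up to the increments `(c' - c) K k (D ⊗ D)`. As `D` is the average of the gradient
of `log Z` over the layers up to `k`, these are the overlaps of two replicas which share the layers
above `k`: they give `φ (k + 1)`. The initial value `K 0 Q`, that is, the Hessian of `Z` divided by
`Z` and paired with half the time derivative of the whole covariance, gives `φ₀₁` and `φ₀₂`. All
the functions grow at most exponentially, which justifies differentiating under the integrals.
-/

noncomputable section

set_option maxSynthPendingDepth 3

namespace GaussianInterpolation

open MeasureTheory ProbabilityTheory Filter Topology

section IntegrationByParts

lemma integrable_exp_mul_abs_gaussianReal (v : NNReal) (B : ℝ) :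
    Integrable (fun x : ℝ => Real.exp (B * |x|)) (gaussianReal 0 v) :=
  integrable_exp_mul_abs (X := fun x : ℝ => x) (integrable_exp_mul_gaussianReal B)
    (integrable_exp_mul_gaussianReal (-B))

lemma hasDerivAt_gaussianPDFReal_zero {v : NNReal} (hv : v ≠ 0) (x : ℝ) :
    HasDerivAt (gaussianPDFReal 0 v) (-(x / v) * gaussianPDFReal 0 v x) x := by
  have h_exponent : HasDerivAt (fun x : ℝ => -(x - 0) ^ 2 / (2 * (v : ℝ))) (-(x / v)) x := by
    refine ((((hasDerivAt_id x).sub_const 0).pow 2).neg.div_const (2 * (v : ℝ))).congr_deriv ?_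
    simp only [Nat.cast_ofNat, id_eq, sub_zero, Nat.add_one_sub_one, pow_one, mul_one]
    field_simp
  rw [gaussianPDFReal_def]
  refine (h_exponent.exp.const_mul (√(2 * Real.pi * (v : ℝ)))⁻¹).congr_deriv ?_
  ring

lemma integrable_mul_gaussianPDFReal {v : NNReal} (hv : v ≠ 0) {g : ℝ → ℝ}
    (hg : Integrable g (gaussianReal 0 v)) : Integrable (fun x => g x * gaussianPDFReal 0 v x) := by
  rw [gaussianReal_of_var_ne_zero _ hv,
    integrable_withDensity_iff_integrable_smul' (measurable_gaussianPDF _ _)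
      (ae_of_all _ fun x => gaussianPDF_lt_top)] at hg
  simpa [toReal_gaussianPDF, mul_comm] using hg

lemma integral_id_mul_gaussianReal {v : NNReal} {f f' : ℝ → ℝ}
    (hderiv : ∀ x, HasDerivAt f (f' x) x) (hf : Integrable f (gaussianReal 0 v))
    (hxf : Integrable (fun x => x * f x) (gaussianReal 0 v))
    (hf' : Integrable f' (gaussianReal 0 v)) :
    ∫ x, x * f x ∂gaussianReal 0 v = v * ∫ x, f' x ∂gaussianReal 0 v := by
  rcases eq_or_ne v 0 with rfl | hv
  · simp [gaussianReal_zero_var]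
  have hv' : (v : ℝ) ≠ 0 := by exact_mod_cast hv
  have by_parts := integral_mul_deriv_eq_deriv_mul_of_integrable
    (fun x _ => hderiv x) (fun x _ => hasDerivAt_gaussianPDFReal_zero hv x)
    (((integrable_mul_gaussianPDFReal hv hxf).const_mul (-(v : ℝ)⁻¹)).congr
      (ae_of_all _ fun x => by simp only [Pi.mul_apply]; ring))
    (integrable_mul_gaussianPDFReal hv hf') (integrable_mul_gaussianPDFReal hv hf)
  have h_left : ∫ x, f x * (-(x / v) * gaussianPDFReal 0 v x)
      = -(v : ℝ)⁻¹ * ∫ x, gaussianPDFReal 0 v x • (x * f x) := by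
    rw [← integral_const_mul]
    exact integral_congr_ae (ae_of_all _ fun x => by simp only [smul_eq_mul]; ring)
  simp only [integral_gaussianReal_eq_integral_smul hv]
  rw [h_left, neg_mul, neg_inj, inv_mul_eq_iff_eq_mul₀ hv'] at by_parts
  simpa only [smul_eq_mul, mul_comm] using by_parts

variable {J : Type*} [Fintype J]

/-- Law of a vector with independent centered normal coordinates of variances `σ`; a coordinate of
variance `0` vanishes almost surely. -/
def gaussPi (σ : J → NNReal) : Measure (J → ℝ) :=
  Measure.pi fun j => gaussianReal 0 (σ j)

instance (σ : J → NNReal) : IsProbabilityMeasure (gaussPi σ) := by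
  unfold gaussPi; infer_instance

/-- Measures on a normed space all of whose exponential moments are finite: they integrate every
function of at most exponential growth. -/
def FiniteExpMoments {Z : Type*} [NormedAddCommGroup Z] [MeasurableSpace Z] (μ : Measure Z) :
    Prop :=
  ∀ B : ℝ, Integrable (fun z => Real.exp (B * ‖z‖)) μ

lemma finiteExpMoments_gaussPi (σ : J → NNReal) : FiniteExpMoments (gaussPi σ) := by
  intro B
  have h_prod : Integrable (fun z : J → ℝ => ∏ j, Real.exp (|B| * |z j|)) (gaussPi σ) :=
    Integrable.fintype_prod (f := fun _ x => Real.exp (|B| * |x|)) fun j =>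
      integrable_exp_mul_abs_gaussianReal (σ j) |B|
  refine h_prod.mono' (by fun_prop) (ae_of_all _ fun z => ?_)
  have h_norm : ‖z‖ ≤ ∑ j, |z j| := (pi_norm_le_iff_of_nonneg (by positivity)).2 fun i =>
    Finset.single_le_sum (f := fun j => |z j|) (fun j _ => abs_nonneg _) (Finset.mem_univ i)
  rw [Real.norm_eq_abs, Real.abs_exp, ← Real.exp_sum, ← Finset.mul_sum]
  exact Real.exp_le_exp.2 (mul_le_mul (le_abs_self B) h_norm (norm_nonneg z) (abs_nonneg B))

variable [DecidableEq J]

lemma measurePreserving_update {X : J → Type*} [∀ j, MeasurableSpace (X j)]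
    (μ : ∀ j, Measure (X j)) [∀ j, IsProbabilityMeasure (μ j)] (j : J) :
    MeasurePreserving (fun w : (∀ j, X j) × X j => Function.update w.1 j w.2)
      ((Measure.pi μ).prod (μ j)) (Measure.pi μ) := by
  have h_meas : Measurable fun w : (∀ j, X j) × X j => Function.update w.1 j w.2 :=
    measurable_update'
  refine ⟨h_meas, (Measure.pi_eq fun s hs => ?_).symm⟩
  have h_preimage : (fun w : (∀ j, X j) × X j => Function.update w.1 j w.2) ⁻¹' Set.univ.pi s
      = Set.univ.pi (Function.update s j Set.univ) ×ˢ s j := by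
    ext w
    simp only [Set.mem_preimage, Set.mem_univ_pi, Set.mem_prod]
    refine ⟨fun h => ⟨fun i => ?_, by simpa using h j⟩, fun h i => ?_⟩ <;>
      rcases eq_or_ne i j with rfl | hi
    · simp
    · simpa [hi] using h i
    · simpa using h.2
    · simpa [hi] using h.1 i
  rw [Measure.map_apply h_meas (MeasurableSet.univ_pi hs), h_preimage, Measure.prod_prod,
    Measure.pi_pi, ← Finset.mul_prod_erase _ _ (Finset.mem_univ j),
    ← Finset.mul_prod_erase _ (fun i => μ i (s i)) (Finset.mem_univ j),
    Function.update_self, measure_univ, one_mul, mul_comm]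
  congr 1
  exact Finset.prod_congr rfl fun i hi => by rw [Function.update_of_ne (Finset.ne_of_mem_erase hi)]

lemma integral_coord_mul_gaussPi (σ : J → NNReal) (j : J) {f f' : (J → ℝ) → ℝ}
    (hderiv : ∀ z u, HasDerivAt (fun u => f (Function.update z j u))
      (f' (Function.update z j u)) u)
    (hf : Integrable f (gaussPi σ)) (hzf : Integrable (fun z => z j * f z) (gaussPi σ))
    (hf' : Integrable f' (gaussPi σ)) :
    ∫ z, z j * f z ∂gaussPi σ = σ j * ∫ z, f' z ∂gaussPi σ := by
  have h_update := measurePreserving_update (fun j => gaussianReal 0 (σ j)) j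
  have fiber_integrable {g : (J → ℝ) → ℝ} (hg : Integrable g (gaussPi σ)) :
      Integrable (fun w : (J → ℝ) × ℝ => g (Function.update w.1 j w.2))
        ((gaussPi σ).prod (gaussianReal 0 (σ j))) :=
    h_update.integrable_comp_of_integrable hg
  have fubini {g : (J → ℝ) → ℝ} (hg : Integrable g (gaussPi σ)) :
      ∫ z, g z ∂gaussPi σ
        = ∫ z, ∫ u, g (Function.update z j u) ∂gaussianReal 0 (σ j) ∂gaussPi σ := by
    rw [← integral_prod _ (fiber_integrable hg)]
    have h_map := integral_map (f := g) h_update.measurable.aemeasurable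
      (by rw [h_update.map_eq]; exact hg.1)
    rwa [h_update.map_eq] at h_map
  rw [fubini hzf, fubini hf', ← integral_const_mul]
  refine integral_congr_ae ?_
  filter_upwards [(fiber_integrable hf).prod_right_ae, (fiber_integrable hzf).prod_right_ae,
    (fiber_integrable hf').prod_right_ae] with z hz hz' hz''
  simp only [Function.update_self] at hz' ⊢
  exact integral_id_mul_gaussianReal (hderiv z) hz hz' hz''

end IntegrationByParts

section Growth

variable {T V E F G : Type*} [NormedAddCommGroup V]
  [NormedAddCommGroup E] [NormedAddCommGroup F] [NormedAddCommGroup G] {S : Set T}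

/-- Functions that are continuous and of at most exponential growth in the space variable, with a
rate that is uniform over the parameters in `S`. -/
structure ExpGrowth (S : Set T) (f : T → V → E) : Prop where
  cont : ∀ t ∈ S, Continuous (f t)
  bdd : ∃ B, 0 ≤ B ∧ ∀ t ∈ S, ∀ v, ‖f t v‖ ≤ Real.exp (B * (1 + ‖v‖))

namespace ExpGrowth

variable {f g : T → V → E}

lemma mono_norm {g : T → V → F} (hg : ExpGrowth S g) (hf : ∀ t ∈ S, Continuous (f t))
    (hfg : ∀ t ∈ S, ∀ v, ‖f t v‖ ≤ ‖g t v‖) : ExpGrowth S f :=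
  let ⟨B, hB, hb⟩ := hg.bdd
  ⟨hf, B, hB, fun t ht v => (hfg t ht v).trans (hb t ht v)⟩

lemma of_bounded {φ : T → E} {K : ℝ} (hφ : ∀ t ∈ S, ‖φ t‖ ≤ K) :
    ExpGrowth S (fun t (_ : V) => φ t) := by
  refine ⟨fun _ _ => continuous_const, |K|, abs_nonneg _, fun t ht v => ?_⟩
  have h_le : |K| ≤ |K| * (1 + ‖v‖) := by nlinarith [abs_nonneg K, norm_nonneg v]
  linarith [hφ t ht, le_abs_self K, Real.add_one_le_exp (|K| * (1 + ‖v‖))]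

lemma const (S : Set T) (e : E) : ExpGrowth S (fun _ (_ : V) => e) :=
  of_bounded (φ := fun _ => e) fun _ _ => le_rfl

lemma of_norm_le_linear {K : ℝ} (hK : 0 ≤ K) (hf : ∀ t ∈ S, Continuous (f t))
    (hfK : ∀ t ∈ S, ∀ v, ‖f t v‖ ≤ K * (1 + ‖v‖)) : ExpGrowth S f :=
  ⟨hf, K, hK, fun t ht v =>
    (hfK t ht v).trans ((le_add_of_nonneg_right zero_le_one).trans (Real.add_one_le_exp _))⟩

lemma add (hf : ExpGrowth S f) (hg : ExpGrowth S g) : ExpGrowth S fun t v => f t v + g t v := by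
  obtain ⟨B, hB, hfB⟩ := hf.bdd
  obtain ⟨D, hD, hgD⟩ := hg.bdd
  refine ⟨fun t ht => (hf.cont t ht).add (hg.cont t ht), B + D + 1, by positivity,
    fun t ht v => ?_⟩
  have hf_le : Real.exp (B * (1 + ‖v‖)) ≤ Real.exp ((B + D) * (1 + ‖v‖)) := by
    gcongr; linarith
  have hg_le : Real.exp (D * (1 + ‖v‖)) ≤ Real.exp ((B + D) * (1 + ‖v‖)) := by
    gcongr; linarith
  have two_le : (2 : ℝ) ≤ Real.exp (1 + ‖v‖) := by
    linarith [Real.add_one_le_exp (1 + ‖v‖), norm_nonneg v]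
  rw [add_mul, one_mul, Real.exp_add]
  nlinarith [norm_add_le (f t v) (g t v), hfB t ht v, hgD t ht v,
    Real.exp_pos ((B + D) * (1 + ‖v‖))]

lemma neg (hf : ExpGrowth S f) : ExpGrowth S fun t v => -f t v :=
  hf.mono_norm (fun t ht => (hf.cont t ht).neg) fun _ _ _ => (norm_neg _).le

lemma sub (hf : ExpGrowth S f) (hg : ExpGrowth S g) : ExpGrowth S fun t v => f t v - g t v := by
  simpa only [sub_eq_add_neg] using hf.add hg.neg

lemma sum {ι : Type*} {s : Finset ι} {f : ι → T → V → E} (hf : ∀ i ∈ s, ExpGrowth S (f i)) :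
    ExpGrowth S fun t v => ∑ i ∈ s, f i t v := by
  classical
  induction s using Finset.induction_on with
  | empty => simpa only [Finset.sum_empty] using const S 0
  | insert i s hi ih =>
    simp only [Finset.sum_insert hi]
    exact (hf i (Finset.mem_insert_self _ _)).add
      (ih fun k hk => hf k (Finset.mem_insert_of_mem hk))

lemma mul {f g : T → V → ℝ} (hf : ExpGrowth S f) (hg : ExpGrowth S g) :
    ExpGrowth S fun t v => f t v * g t v := by
  obtain ⟨B, hB, hfB⟩ := hf.bdd
  obtain ⟨D, hD, hgD⟩ := hg.bdd
  refine ⟨fun t ht => (hf.cont t ht).mul (hg.cont t ht), B + D, by positivity, fun t ht v => ?_⟩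
  rw [add_mul, Real.exp_add, norm_mul]
  exact mul_le_mul (hfB t ht v) (hgD t ht v) (norm_nonneg _) (Real.exp_pos _).le

lemma norm (hf : ExpGrowth S f) : ExpGrowth S fun t v => ‖f t v‖ :=
  hf.mono_norm (fun t ht => (hf.cont t ht).norm) fun _ _ _ => (norm_norm _).le

lemma comp {W : Type*} [NormedAddCommGroup W] {φ : T → W → V} {K : ℝ} (hf : ExpGrowth S f)
    (hφ : ∀ t ∈ S, Continuous (φ t)) (hK : 0 ≤ K)
    (hφK : ∀ t ∈ S, ∀ w, 1 + ‖φ t w‖ ≤ K * (1 + ‖w‖)) : ExpGrowth S fun t w => f t (φ t w) := by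
  obtain ⟨B, hB, hb⟩ := hf.bdd
  refine ⟨fun t ht => (hf.cont t ht).comp (hφ t ht), B * K, by positivity, fun t ht w =>
    (hb t ht _).trans (Real.exp_le_exp.2 ?_)⟩
  rw [mul_assoc]
  exact mul_le_mul_of_nonneg_left (hφK t ht w) hB

variable [NormedSpace ℝ E] [NormedSpace ℝ F] [NormedSpace ℝ G]

lemma bilin (L : E →L[ℝ] F →L[ℝ] G) {g : T → V → F} (hf : ExpGrowth S f) (hg : ExpGrowth S g) :
    ExpGrowth S fun t v => L (f t v) (g t v) :=
  (((const S ‖L‖).mul hf.norm).mul hg.norm).mono_norm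
    (fun t ht => (L.continuous.comp (hf.cont t ht)).clm_apply (hg.cont t ht)) fun t _ v => by
      simpa only [norm_mul, norm_norm, Real.norm_of_nonneg (norm_nonneg L)] using
        L.le_opNorm₂ (f t v) (g t v)

lemma clm (L : E →L[ℝ] F) (hf : ExpGrowth S f) : ExpGrowth S fun t v => L (f t v) :=
  .bilin (ContinuousLinearMap.apply ℝ F) hf (const S L)

lemma smul {c : T → V → ℝ} (hc : ExpGrowth S c) (hf : ExpGrowth S f) :
    ExpGrowth S fun t v => c t v • f t v :=
  hc.bilin (ContinuousLinearMap.lsmul ℝ ℝ) hf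

end ExpGrowth

/-- Positive functions that grow and decay at most exponentially: the class of the partition
functions, stable under real powers and under Gaussian averaging. -/
structure PosExpGrowth (S : Set T) (W : T → V → ℝ) : Prop where
  pos : ∀ t ∈ S, ∀ v, 0 < W t v
  growth : ExpGrowth S W
  growth_inv : ExpGrowth S fun t v => (W t v)⁻¹

namespace PosExpGrowth

variable {U W : T → V → ℝ}

lemma inv (hW : PosExpGrowth S W) : PosExpGrowth S fun t v => (W t v)⁻¹ :=
  ⟨fun t ht v => inv_pos.2 (hW.pos t ht v), hW.growth_inv, by simpa only [inv_inv] using hW.growth⟩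

lemma mul (hU : PosExpGrowth S U) (hW : PosExpGrowth S W) :
    PosExpGrowth S fun t v => U t v * W t v :=
  ⟨fun t ht v => mul_pos (hU.pos t ht v) (hW.pos t ht v), hU.growth.mul hW.growth,
    by simpa only [mul_inv] using hU.growth_inv.mul hW.growth_inv⟩

lemma div (hU : PosExpGrowth S U) (hW : PosExpGrowth S W) :
    PosExpGrowth S fun t v => U t v / W t v := by
  simpa only [div_eq_mul_inv] using hU.mul hW.inv

lemma abs_log_le (hW : PosExpGrowth S W) :
    ∃ B, 0 ≤ B ∧ ∀ t ∈ S, ∀ v, |Real.log (W t v)| ≤ B * (1 + ‖v‖) := by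
  obtain ⟨B, hB, hb⟩ := hW.growth.bdd
  obtain ⟨D, hD, hd⟩ := hW.growth_inv.bdd
  refine ⟨B + D, by positivity, fun t ht v => ?_⟩
  have hpos := hW.pos t ht v
  have h_upper : Real.log (W t v) ≤ B * (1 + ‖v‖) :=
    (Real.log_le_iff_le_exp hpos).2 ((le_abs_self _).trans (hb t ht v))
  have h_lower : -Real.log (W t v) ≤ D * (1 + ‖v‖) := by
    rw [← Real.log_inv]
    exact (Real.log_le_iff_le_exp (inv_pos.2 hpos)).2 ((le_abs_self _).trans (hd t ht v))
  have := mul_nonneg hB (add_nonneg zero_le_one (norm_nonneg v))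
  have := mul_nonneg hD (add_nonneg zero_le_one (norm_nonneg v))
  rw [abs_le, add_mul]
  constructor <;> linarith

lemma growth_log (hW : PosExpGrowth S W) : ExpGrowth S fun t v => Real.log (W t v) :=
  let ⟨_, hB, hb⟩ := hW.abs_log_le
  .of_norm_le_linear hB
    (fun t ht => (hW.growth.cont t ht).log fun v => (hW.pos t ht v).ne') hb

lemma growth_rpow (hW : PosExpGrowth S W) (a : ℝ) : ExpGrowth S fun t v => W t v ^ a := by
  obtain ⟨B, hB, hb⟩ := hW.abs_log_le
  refine ⟨fun t ht => (hW.growth.cont t ht).rpow_const fun v => .inl (hW.pos t ht v).ne',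
    |a| * B, by positivity, fun t ht v => ?_⟩
  rw [Real.norm_of_nonneg (Real.rpow_nonneg (hW.pos t ht v).le a),
    Real.rpow_def_of_pos (hW.pos t ht v), mul_comm]
  refine Real.exp_le_exp.2 ((le_abs_self _).trans ?_)
  rw [abs_mul, mul_assoc]
  exact mul_le_mul_of_nonneg_left (hb t ht v) (abs_nonneg a)

lemma rpow (hW : PosExpGrowth S W) (a : ℝ) : PosExpGrowth S fun t v => W t v ^ a where
  pos t ht v := Real.rpow_pos_of_pos (hW.pos t ht v) a
  growth := hW.growth_rpow a
  growth_inv := (hW.growth_rpow (-a)).mono_norm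
    (fun t ht => ((hW.growth_rpow a).cont t ht).inv₀ fun v =>
      (Real.rpow_pos_of_pos (hW.pos t ht v) a).ne')
    fun t ht v => by rw [Real.rpow_neg (hW.pos t ht v).le]

lemma exp_clm [NormedSpace ℝ V] (S : Set T) (L : V →L[ℝ] ℝ) :
    PosExpGrowth S fun _ v => Real.exp (L v) := by
  have growth_exp (L : V →L[ℝ] ℝ) : ExpGrowth S fun _ v => Real.exp (L v) := by
    refine ⟨fun _ _ => by fun_prop, ‖L‖, norm_nonneg _, fun _ _ v => ?_⟩
    rw [Real.norm_eq_abs, Real.abs_exp, Real.exp_le_exp]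
    nlinarith [(le_abs_self _).trans (L.le_opNorm v), norm_nonneg L]
  refine ⟨fun _ _ _ => Real.exp_pos _, growth_exp L, ?_⟩
  simpa only [neg_apply, Real.exp_neg] using growth_exp (-L)

lemma sum {ι : Type*} {s : Finset ι} (hs : s.Nonempty) {W : ι → T → V → ℝ}
    (hW : ∀ i ∈ s, PosExpGrowth S (W i)) : PosExpGrowth S fun t v => ∑ i ∈ s, W i t v := by
  have hpos : ∀ t ∈ S, ∀ v, 0 < ∑ i ∈ s, W i t v := fun t ht v =>
    Finset.sum_pos (fun i hi => (hW i hi).pos t ht v) hs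
  have h_growth : ExpGrowth S fun t v => ∑ i ∈ s, W i t v := .sum fun i hi => (hW i hi).growth
  obtain ⟨i, hi⟩ := hs
  refine ⟨hpos, h_growth, (hW i hi).growth_inv.mono_norm
    (fun t ht => (h_growth.cont t ht).inv₀ fun v => (hpos t ht v).ne') fun t ht v => ?_⟩
  have hWi := (hW i hi).pos t ht v
  rw [Real.norm_of_nonneg (inv_pos.2 (hpos t ht v)).le, Real.norm_of_nonneg (inv_pos.2 hWi).le]
  exact inv_anti₀ hWi (Finset.single_le_sum (fun k hk => ((hW k hk).pos t ht v).le) hi)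

end PosExpGrowth

end Growth

section Average

variable {T V Z E F : Type*} [NormedAddCommGroup V] [NormedAddCommGroup E] [NormedAddCommGroup F]
  [NormedAddCommGroup Z]

namespace ExpGrowth

variable {S : Set T}

lemma bdd_prod {f : T → V × Z → E} (hf : ExpGrowth S f) :
    ∃ B, 0 ≤ B ∧ ∀ t ∈ S, ∀ v z,
      ‖f t (v, z)‖ ≤ Real.exp (B * (1 + ‖v‖)) * Real.exp (B * ‖z‖) := by
  obtain ⟨B, hB, hb⟩ := hf.bdd
  refine ⟨B, hB, fun t ht v z => (hb t ht _).trans ?_⟩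
  rw [← Real.exp_add, ← mul_add, add_assoc]
  gcongr
  exact max_le_add_of_nonneg (norm_nonneg v) (norm_nonneg z)

lemma bdd_ball {f : T → V × Z → E} (hf : ExpGrowth S f) (v : V) :
    ∃ B C, ∀ t ∈ S, ∀ w ∈ Metric.ball v 1, ∀ z, ‖f t (w, z)‖ ≤ C * Real.exp (B * ‖z‖) := by
  obtain ⟨B, hB, hb⟩ := hf.bdd_prod
  refine ⟨B, Real.exp (B * (1 + (‖v‖ + 1))), fun t ht w hw z => (hb t ht w z).trans ?_⟩
  have hw_norm : ‖w‖ ≤ ‖v‖ + 1 := by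
    linarith [norm_le_norm_add_norm_sub' w v, mem_ball_iff_norm.1 hw]
  gcongr

end ExpGrowth

section Noise

variable [NormedSpace ℝ V] [NormedSpace ℝ Z]

/-- A differentiable family of linear maps on an open set of times, bounded together with its
derivative: the time dependent coefficients of a noise. -/
structure SmoothPath (S : Set ℝ) (L L' : ℝ → Z →L[ℝ] V) : Prop where
  isOpen : IsOpen S
  hasDerivAt : ∀ t ∈ S, HasDerivAt L (L' t) t
  bdd : ∃ K, 0 ≤ K ∧ ∀ t ∈ S, ‖L t‖ ≤ K ∧ ‖L' t‖ ≤ K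

namespace SmoothPath

variable {S : Set ℝ} {L L' : ℝ → Z →L[ℝ] V}

lemma growth_shift (hL : SmoothPath S L L') {f : ℝ → V → E} (hf : ExpGrowth S f) :
    ExpGrowth S fun t (w : V × Z) => f t (w.1 + L t w.2) := by
  obtain ⟨K, hK, hb⟩ := hL.bdd
  refine hf.comp (K := 1 + K) (fun t _ => by fun_prop) (by positivity) fun t ht w => ?_
  have h_noise : ‖L t w.2‖ ≤ K * ‖w‖ :=
    (L t).le_of_opNorm_le_of_le (hb t ht).1 (norm_snd_le w)
  nlinarith [norm_add_le w.1 (L t w.2), norm_fst_le w]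

lemma growth_noise (hL : SmoothPath S L L') :
    ExpGrowth S fun t (w : V × Z) => L' t w.2 := by
  obtain ⟨K, hK, hb⟩ := hL.bdd
  refine .of_norm_le_linear hK (fun t _ => by fun_prop) fun t ht w => ?_
  have h_noise : ‖L' t w.2‖ ≤ K * ‖w‖ :=
    (L' t).le_of_opNorm_le_of_le (hb t ht).2 (norm_snd_le w)
  linarith

end SmoothPath

end Noise

variable [MeasurableSpace Z] [BorelSpace Z] [SecondCountableTopology Z] {μ : Measure Z}

namespace ExpGrowth

variable {S : Set T}

lemma aestronglyMeasurable {f : T → V × Z → E} (hf : ExpGrowth S f) {t : T} (ht : t ∈ S) (v : V) :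
    AEStronglyMeasurable (fun z => f t (v, z)) μ :=
  ((hf.cont t ht).comp (by fun_prop : Continuous fun z : Z => (v, z))).aestronglyMeasurable

lemma integrable {f : T → V × Z → E} (hf : ExpGrowth S f) (hμ : FiniteExpMoments μ) {t : T}
    (ht : t ∈ S) (v : V) : Integrable (fun z => f t (v, z)) μ :=
  let ⟨B, _, hb⟩ := hf.bdd_prod
  ((hμ B).const_mul _).mono' (hf.aestronglyMeasurable ht v) (ae_of_all _ fun z => hb t ht v z)

variable [NormedSpace ℝ E]

lemma integral {f : T → V × Z → E} (hf : ExpGrowth S f) (hμ : FiniteExpMoments μ) :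
    ExpGrowth S fun t v => ∫ z, f t (v, z) ∂μ := by
  constructor
  · refine fun t ht => continuous_iff_continuousAt.2 fun v => ?_
    obtain ⟨B, C, hBC⟩ := hf.bdd_ball v
    refine continuousAt_of_dominated
      (Eventually.of_forall fun w => hf.aestronglyMeasurable ht w) ?_ ((hμ B).const_mul C)
      (ae_of_all _ fun z => ((hf.cont t ht).comp (Continuous.prodMk_left z)).continuousAt)
    filter_upwards [Metric.ball_mem_nhds v one_pos] with w hw
    exact ae_of_all _ fun z => hBC t ht w hw z
  · obtain ⟨B, hB, hb⟩ := hf.bdd_prod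
    set M := ∫ z, Real.exp (B * ‖z‖) ∂μ
    have hM : 0 ≤ M := integral_nonneg fun z => (Real.exp_pos _).le
    refine ⟨B + M, by positivity, fun t ht v => ?_⟩
    calc ‖∫ z, f t (v, z) ∂μ‖ ≤ ∫ z, Real.exp (B * (1 + ‖v‖)) * Real.exp (B * ‖z‖) ∂μ :=
          norm_integral_le_of_norm_le ((hμ B).const_mul _) (ae_of_all _ fun z => hb t ht v z)
      _ = Real.exp (B * (1 + ‖v‖)) * M := integral_const_mul _ _
      _ ≤ Real.exp (B * (1 + ‖v‖)) * Real.exp (M * (1 + ‖v‖)) := by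
          gcongr
          nlinarith [Real.add_one_le_exp (M * (1 + ‖v‖)), norm_nonneg v]
      _ = Real.exp ((B + M) * (1 + ‖v‖)) := by rw [← Real.exp_add, add_mul]

variable [NormedSpace ℝ V]

lemma hasFDerivAt_integral {f : T → V × Z → E} {f' : T → V × Z → V →L[ℝ] E}
    (hμ : FiniteExpMoments μ) (hf : ExpGrowth S f) (hf' : ExpGrowth S f') {t : T} (ht : t ∈ S)
    (hderiv : ∀ v z, HasFDerivAt (fun v => f t (v, z)) (f' t (v, z)) v) (v : V) :
    HasFDerivAt (fun v => ∫ z, f t (v, z) ∂μ) (∫ z, f' t (v, z) ∂μ) v := by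
  obtain ⟨B, C, hBC⟩ := hf'.bdd_ball v
  exact hasFDerivAt_integral_of_dominated_of_fderiv_le (Metric.ball_mem_nhds v one_pos)
    (Eventually.of_forall fun w => hf.aestronglyMeasurable ht w) (hf.integrable hμ ht v)
    (hf'.aestronglyMeasurable ht v) (ae_of_all _ fun z w hw => hBC t ht w hw z)
    ((hμ B).const_mul C) (ae_of_all _ fun z w _ => hderiv w z)

lemma hasFDerivAt_integral_time {S : Set ℝ} {f : ℝ → V × Z → E} {f' : ℝ → V × Z → ℝ × V →L[ℝ] E}
    (hμ : FiniteExpMoments μ) (hS : IsOpen S) (hf : ExpGrowth S f) (hf' : ExpGrowth S f')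
    (hderiv : ∀ t ∈ S, ∀ v z,
      HasFDerivAt (fun w : ℝ × V => f w.1 (w.2, z)) (f' t (v, z)) (t, v))
    {t : ℝ} (ht : t ∈ S) (v : V) :
    HasFDerivAt (fun w : ℝ × V => ∫ z, f w.1 (w.2, z) ∂μ) (∫ z, f' t (v, z) ∂μ) (t, v) := by
  obtain ⟨B, C, hBC⟩ := hf'.bdd_ball v
  have hU : S ×ˢ Metric.ball v 1 ∈ 𝓝 (t, v) :=
    prod_mem_nhds (hS.mem_nhds ht) (Metric.ball_mem_nhds v one_pos)
  exact hasFDerivAt_integral_of_dominated_of_fderiv_le (F := fun w z => f w.1 (w.2, z))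
    (F' := fun w z => f' w.1 (w.2, z)) hU
    (by filter_upwards [hU] with w hw using hf.aestronglyMeasurable hw.1 w.2)
    (hf.integrable hμ ht v) (hf'.aestronglyMeasurable ht v)
    (ae_of_all _ fun z w hw => hBC w.1 hw.1 w.2 hw.2 z) ((hμ B).const_mul C)
    (ae_of_all _ fun z w hw => hderiv w.1 hw.1 w.2 z)

end ExpGrowth

variable [NormedSpace ℝ V] [NormedSpace ℝ E] [NormedSpace ℝ Z]

/-- The average of `f t (v + X)` over the image `X = L t z` of the noise `z` of law `μ`. -/
def avg (μ : Measure Z) (L : T → Z →L[ℝ] V) (f : T → V → E) (t : T) (v : V) : E :=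
  ∫ z, f t (v + L t z) ∂μ

namespace SmoothPath

variable {S : Set ℝ} {L L' : ℝ → Z →L[ℝ] V} {f : ℝ → V → E}

lemma integrable (hL : SmoothPath S L L') (hμ : FiniteExpMoments μ) {f : ℝ → V → F}
    (hf : ExpGrowth S f) {t : ℝ} (ht : t ∈ S) (v : V) : Integrable (fun z => f t (v + L t z)) μ :=
  (hL.growth_shift hf).integrable hμ ht v

lemma growth_avg (hL : SmoothPath S L L') (hμ : FiniteExpMoments μ) (hf : ExpGrowth S f) :
    ExpGrowth S (avg μ L f) :=
  (hL.growth_shift hf).integral hμ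

lemma avg_add (hL : SmoothPath S L L') (hμ : FiniteExpMoments μ) {g : ℝ → V → E}
    (hf : ExpGrowth S f) (hg : ExpGrowth S g) {t : ℝ} (ht : t ∈ S) (v : V) :
    avg μ L (fun t v => f t v + g t v) t v = avg μ L f t v + avg μ L g t v :=
  integral_add (hL.integrable hμ hf ht v) (hL.integrable hμ hg ht v)

lemma avg_clm [CompleteSpace E] [NormedSpace ℝ F] [CompleteSpace F]
    (hL : SmoothPath S L L') (hμ : FiniteExpMoments μ) (M : E →L[ℝ] F) (hf : ExpGrowth S f)
    {t : ℝ} (ht : t ∈ S) (v : V) :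
    avg μ L (fun t v => M (f t v)) t v = M (avg μ L f t v) :=
  M.integral_comp_comm (hL.integrable hμ hf ht v)

variable [IsProbabilityMeasure μ] {W : ℝ → V → ℝ}

lemma avg_pos (hL : SmoothPath S L L') (hμ : FiniteExpMoments μ) (hW : PosExpGrowth S W)
    {t : ℝ} (ht : t ∈ S) (v : V) : 0 < avg μ L W t v := by
  refine (integral_pos_iff_support_of_nonneg (fun z => (hW.pos t ht _).le)
    (hL.integrable hμ hW.growth ht v)).2 ?_
  rw [Set.eq_univ_of_forall fun z => Function.mem_support.2 (hW.pos t ht (v + L t z)).ne']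
  simp

lemma inv_avg_le_avg_inv (hL : SmoothPath S L L') (hμ : FiniteExpMoments μ)
    (hW : PosExpGrowth S W) {t : ℝ} (ht : t ∈ S) (v : V) :
    (avg μ L W t v)⁻¹ ≤ avg μ L (fun t v => (W t v)⁻¹) t v := by
  set a := avg μ L W t v with ha
  have ha_pos : 0 < a := hL.avg_pos hμ hW ht v
  have h_int := hL.integrable hμ hW.growth ht v
  have h_tangent : ∀ w, 2 * a⁻¹ - a⁻¹ ^ 2 * W t w ≤ (W t w)⁻¹ := fun w => by
    have := hW.pos t ht w
    have h_sq : (W t w)⁻¹ - (2 * a⁻¹ - a⁻¹ ^ 2 * W t w) = (W t w - a) ^ 2 / (W t w * a ^ 2) := by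
      field_simp
      ring
    rw [← sub_nonneg, h_sq]
    positivity
  calc a⁻¹ = 2 * a⁻¹ - a⁻¹ ^ 2 * a := by field_simp; ring
    _ = ∫ z, (2 * a⁻¹ - a⁻¹ ^ 2 * W t (v + L t z)) ∂μ := by
        rw [integral_sub (integrable_const _) (h_int.const_mul _), integral_const,
          integral_const_mul]
        simp [ha, avg]
    _ ≤ _ := integral_mono ((integrable_const _).sub (h_int.const_mul _))
        (hL.integrable hμ hW.growth_inv ht v) fun z => h_tangent _

lemma posExpGrowth_avg (hL : SmoothPath S L L') (hμ : FiniteExpMoments μ)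
    (hW : PosExpGrowth S W) : PosExpGrowth S (avg μ L W) := by
  have hpos : ∀ t ∈ S, ∀ v, 0 < avg μ L W t v := fun t ht v => hL.avg_pos hμ hW ht v
  have h_growth := hL.growth_avg hμ hW.growth
  refine ⟨hpos, h_growth, (hL.growth_avg hμ hW.growth_inv).mono_norm
    (fun t ht => (h_growth.cont t ht).inv₀ fun v => (hpos t ht v).ne') fun t ht v => ?_⟩
  rw [Real.norm_of_nonneg (inv_pos.2 (hpos t ht v)).le]
  exact (hL.inv_avg_le_avg_inv hμ hW ht v).trans (le_abs_self _)

end SmoothPath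

end Average

section Jets

variable {V : Type*} [NormedAddCommGroup V] [NormedSpace ℝ V]

/-- The derivative on time and space with time derivative `h` and spatial derivative `D`. -/
def timeSpaceDeriv (h : ℝ) (D : V →L[ℝ] ℝ) : ℝ × V →L[ℝ] ℝ :=
  (ContinuousLinearMap.fst ℝ ℝ V).smulRight h + D ∘L ContinuousLinearMap.snd ℝ ℝ V

lemma timeSpaceDeriv_apply (h : ℝ) (D : V →L[ℝ] ℝ) (w : ℝ × V) :
    timeSpaceDeriv h D w = w.1 * h + D w.2 := rfl

lemma ExpGrowth.timeSpaceDeriv {T U : Type*} [NormedAddCommGroup U] {S : Set T}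
    {h : T → U → ℝ} {D : T → U → V →L[ℝ] ℝ} (hh : ExpGrowth S h) (hD : ExpGrowth S D) :
    ExpGrowth S fun t u => timeSpaceDeriv (h t u) (D t u) :=
  (hh.clm (ContinuousLinearMap.smulRightL ℝ (ℝ × V) ℝ (.fst ℝ ℝ V))).add
    (hD.clm ((ContinuousLinearMap.compL ℝ (ℝ × V) V ℝ).flip (.snd ℝ ℝ V)))

/-- `g` has time derivative `h`, gradient `D` and Hessian `Q` at the times in `S`, all of them of
exponential growth. -/
structure IsJet (S : Set ℝ) (g h : ℝ → V → ℝ) (D : ℝ → V → V →L[ℝ] ℝ)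
    (Q : ℝ → V → V →L[ℝ] V →L[ℝ] ℝ) : Prop where
  growth : ExpGrowth S g
  growth_time : ExpGrowth S h
  growth_grad : ExpGrowth S D
  growth_hess : ExpGrowth S Q
  hasFDerivAt : ∀ t ∈ S, ∀ v,
    HasFDerivAt (fun w : ℝ × V => g w.1 w.2) (timeSpaceDeriv (h t v) (D t v)) (t, v)
  hasFDerivAt_grad : ∀ t ∈ S, ∀ v, HasFDerivAt (D t) (Q t v) v

lemma IsJet.hasDerivAt {S : Set ℝ} {g h : ℝ → V → ℝ} {D : ℝ → V → V →L[ℝ] ℝ}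
    {Q : ℝ → V → V →L[ℝ] V →L[ℝ] ℝ} (hg : IsJet S g h D Q) {t : ℝ} (ht : t ∈ S) (v : V) :
    HasDerivAt (fun τ => g τ v) (h t v) t := by
  simpa [Function.comp_def, timeSpaceDeriv_apply] using
    (hg.hasFDerivAt t ht v).comp_hasDerivAt t ((hasDerivAt_id t).prodMk (hasDerivAt_const t v))

lemma SmoothPath.hasFDerivAt_shift {Z : Type*} [NormedAddCommGroup Z] [NormedSpace ℝ Z]
    {S : Set ℝ} {L L' : ℝ → Z →L[ℝ] V} (hL : SmoothPath S L L') {t : ℝ} (ht : t ∈ S) (v : V) (z : Z)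
    {f : ℝ → V → ℝ} {f₁ : ℝ} {f₂ : V →L[ℝ] ℝ}
    (hf : HasFDerivAt (fun w : ℝ × V => f w.1 w.2) (timeSpaceDeriv f₁ f₂) (t, v + L t z)) :
    HasFDerivAt (fun w : ℝ × V => f w.1 (w.2 + L w.1 z))
      (timeSpaceDeriv (f₁ + f₂ (L' t z)) f₂) (t, v) := by
  have h_noise : HasFDerivAt (fun w : ℝ × V => L w.1 z)
      ((ContinuousLinearMap.fst ℝ ℝ V).smulRight (L' t z)) (t, v) := by
    have := ((hL.hasDerivAt t ht).clm_apply (hasDerivAt_const t z)).hasFDerivAt.comp (t, v)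
      (hasFDerivAt_fst (𝕜 := ℝ) (p := (t, v)))
    refine this.congr_fderiv ?_
    ext w <;> simp
  refine (hf.comp (t, v) (hasFDerivAt_fst.prodMk (hasFDerivAt_snd.add h_noise))).congr_fderiv ?_
  ext w <;> simp [timeSpaceDeriv_apply]

section HeatEquation

variable {J : Type*} [Fintype J]

lemma ExpGrowth.coord {T U : Type*} [NormedAddCommGroup U] (S : Set T) (j : J) :
    ExpGrowth S fun _ (w : U × (J → ℝ)) => w.2 j :=
  .of_norm_le_linear zero_le_one (fun _ _ => by fun_prop) fun _ _ w => by
    linarith [(norm_le_pi_norm w.2 j).trans (norm_snd_le w)]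

variable [DecidableEq J]

/-- `Q ↦ 𝔼 Q(A X, B X)` for a vector `X` with independent centered coordinates of variances `σ`. -/
def covForm (σ : J → NNReal) (A B : (J → ℝ) →L[ℝ] V) : (V →L[ℝ] V →L[ℝ] ℝ) →L[ℝ] ℝ :=
  ∑ j, (σ j : ℝ) • (ContinuousLinearMap.apply ℝ ℝ (B (Pi.single j 1))
    ∘L ContinuousLinearMap.apply ℝ (V →L[ℝ] ℝ) (A (Pi.single j 1)))

lemma covForm_apply (σ : J → NNReal) (A B : (J → ℝ) →L[ℝ] V) (Q : V →L[ℝ] V →L[ℝ] ℝ) :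
    covForm σ A B Q = ∑ j, σ j * Q (A (Pi.single j 1)) (B (Pi.single j 1)) := by
  simp [covForm, sum_apply]

variable {S : Set ℝ} {L L' : ℝ → (J → ℝ) →L[ℝ] V} {σ : J → NNReal}
  {g h : ℝ → V → ℝ} {D : ℝ → V → V →L[ℝ] ℝ} {Q : ℝ → V → V →L[ℝ] V →L[ℝ] ℝ}

lemma SmoothPath.growth_covForm (hL : SmoothPath S L L') (hQ : ExpGrowth S Q) :
    ExpGrowth S fun t v => covForm σ (L t) (L' t) (Q t v) := by
  obtain ⟨K, _, hb⟩ := hL.bdd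
  have growth_column {M : ℝ → (J → ℝ) →L[ℝ] V} (hM : ∀ t ∈ S, ‖M t‖ ≤ K) (j : J) :
      ExpGrowth S fun t (_ : V) => M t (Pi.single j 1) :=
    .of_bounded fun t ht =>
      ((M t).le_opNorm_of_le le_rfl).trans (mul_le_mul_of_nonneg_right (hM t ht) (norm_nonneg _))
  simp only [covForm_apply]
  exact .sum fun j _ => (ExpGrowth.const S (σ j : ℝ)).mul <|
    .bilin (.id ℝ _) (.bilin (.id ℝ _) hQ (growth_column (fun t ht => (hb t ht).1) j))
      (growth_column (fun t ht => (hb t ht).2) j)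

lemma SmoothPath.integral_coord_mul (hL : SmoothPath S L L') {f : ℝ → V → ℝ}
    {f' : ℝ → V → V →L[ℝ] ℝ} (hf : ExpGrowth S f) (hf' : ExpGrowth S f') {t : ℝ} (ht : t ∈ S)
    (hderiv : ∀ v, HasFDerivAt (f t) (f' t v) v) (v : V) (j : J) :
    ∫ z, z j * f t (v + L t z) ∂gaussPi σ
      = σ j * ∫ z, f' t (v + L t z) (L t (Pi.single j 1)) ∂gaussPi σ := by
  have hσ := finiteExpMoments_gaussPi σ
  refine integral_coord_mul_gaussPi σ j (fun z u => ?_) (hL.integrable hσ hf ht v)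
    (((ExpGrowth.coord S j).mul (hL.growth_shift hf)).integrable hσ ht v)
    ((hL.integrable hσ hf' ht v).apply_continuousLinearMap _)
  have h_line : HasDerivAt (fun u => v + L t (Function.update z j u)) (L t (Pi.single j 1)) u :=
    ((L t).hasFDerivAt.comp_hasDerivAt u (hasDerivAt_update z j u)).const_add v
  exact (hderiv _).comp_hasDerivAt u h_line

lemma SmoothPath.integral_grad_noise (hL : SmoothPath S L L') (hD : ExpGrowth S D)
    (hQ : ExpGrowth S Q) {t : ℝ} (ht : t ∈ S) (hderiv : ∀ v, HasFDerivAt (D t) (Q t v) v)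
    (v : V) :
    ∫ z, D t (v + L t z) (L' t z) ∂gaussPi σ
      = covForm σ (L t) (L' t) (avg (gaussPi σ) L Q t v) := by
  have hσ := finiteExpMoments_gaussPi σ
  set e : J → V := fun j => L' t (Pi.single j 1) with he
  have growth_coord (j : J) : ExpGrowth S fun t v => D t v (e j) :=
    hD.clm (ContinuousLinearMap.apply ℝ ℝ (e j))
  have growth_coord' (j : J) :
      ExpGrowth S fun t v => ContinuousLinearMap.apply ℝ ℝ (e j) ∘L Q t v :=
    hQ.clm (ContinuousLinearMap.compL ℝ V (V →L[ℝ] ℝ) ℝ (ContinuousLinearMap.apply ℝ ℝ (e j)))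
  have by_parts (j : J) : ∫ z, z j * D t (v + L t z) (e j) ∂gaussPi σ
      = σ j * avg (gaussPi σ) L Q t v (L t (Pi.single j 1)) (e j) := by
    have int_hess := hL.integrable hσ hQ ht v
    rw [avg, ContinuousLinearMap.integral_apply int_hess,
      ContinuousLinearMap.integral_apply (int_hess.apply_continuousLinearMap _)]
    exact hL.integral_coord_mul (growth_coord j) (growth_coord' j) ht
      (fun v => (ContinuousLinearMap.apply ℝ ℝ (e j)).hasFDerivAt.comp v (hderiv v)) v j
  have noise_eq (z : J → ℝ) : L' t z = ∑ j, z j • e j := by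
    conv_lhs => rw [pi_eq_sum_univ' z, map_sum]
    simp only [map_smul, he]
  simp only [noise_eq, map_sum, map_smul, smul_eq_mul]
  rw [integral_finsetSum _ fun j _ =>
    ((ExpGrowth.coord S j).mul (hL.growth_shift (growth_coord j))).integrable hσ ht v,
    covForm_apply]
  exact Finset.sum_congr rfl fun j _ => by_parts j

lemma IsJet.avg (hg : IsJet S g h D Q) (hL : SmoothPath S L L') :
    IsJet S (avg (gaussPi σ) L g)
      (fun t v => avg (gaussPi σ) L h t v
        + covForm σ (L t) (L' t) (avg (gaussPi σ) L Q t v))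
      (avg (gaussPi σ) L D) (avg (gaussPi σ) L Q) where
  growth := hL.growth_avg (finiteExpMoments_gaussPi σ) hg.growth
  growth_time := (hL.growth_avg (finiteExpMoments_gaussPi σ) hg.growth_time).add
    (hL.growth_covForm (hL.growth_avg (finiteExpMoments_gaussPi σ) hg.growth_hess))
  growth_grad := hL.growth_avg (finiteExpMoments_gaussPi σ) hg.growth_grad
  growth_hess := hL.growth_avg (finiteExpMoments_gaussPi σ) hg.growth_hess
  hasFDerivAt t ht v := by
    have hσ := finiteExpMoments_gaussPi σ
    have growth_noise_grad := ExpGrowth.bilin (.id ℝ _) (hL.growth_shift hg.growth_grad)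
      hL.growth_noise
    have growth_time := (hL.growth_shift hg.growth_time).add growth_noise_grad
    have growth_deriv := growth_time.timeSpaceDeriv (hL.growth_shift hg.growth_grad)
    refine ((hL.growth_shift hg.growth).hasFDerivAt_integral_time hσ hL.isOpen growth_deriv
      (fun t ht v z => hL.hasFDerivAt_shift ht v z (hg.hasFDerivAt t ht _)) ht v).congr_fderiv ?_
    refine ContinuousLinearMap.ext fun w => ?_
    rw [ContinuousLinearMap.integral_apply (growth_deriv.integrable hσ ht v)]
    simp only [timeSpaceDeriv_apply]
    rw [integral_add ((growth_time.integrable hσ ht v).const_mul _)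
        ((hL.integrable hσ hg.growth_grad ht v).apply_continuousLinearMap _),
      integral_const_mul, integral_add (hL.integrable hσ hg.growth_time ht v)
        (growth_noise_grad.integrable hσ ht v),
      ← ContinuousLinearMap.integral_apply (hL.integrable hσ hg.growth_grad ht v)]
    congr 3
    exact hL.integral_grad_noise hg.growth_grad hg.growth_hess ht (hg.hasFDerivAt_grad t ht) v
  hasFDerivAt_grad t ht v :=
    (hL.growth_shift hg.growth_grad).hasFDerivAt_integral (finiteExpMoments_gaussPi σ)
      (hL.growth_shift hg.growth_hess) ht
      (fun v z => (hasFDerivAt_comp_add_right (L t z)).2 (hg.hasFDerivAt_grad t ht _)) v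

end HeatEquation

end Jets

section LogJets

section Tilt

variable {V Z E F : Type*} [NormedAddCommGroup V] [NormedSpace ℝ V] [NormedAddCommGroup Z]
  [NormedSpace ℝ Z] [MeasurableSpace Z] [NormedAddCommGroup E] [NormedSpace ℝ E]
  [NormedAddCommGroup F] [NormedSpace ℝ F] {μ : Measure Z}

/-- The average of `f` over the noise, reweighted by `U`. -/
def tilt {T : Type*} (μ : Measure Z) (L : T → Z →L[ℝ] V) (U : T → V → ℝ) (f : T → V → E) (t : T)
    (v : V) : E :=
  (avg μ L U t v)⁻¹ • avg μ L (fun t v => U t v • f t v) t v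

lemma avg_mul_smul {T : Type*} {L : T → Z →L[ℝ] V} {U : T → V → ℝ} {t : T} {v : V}
    (hU : avg μ L U t v ≠ 0) (a : ℝ) (f : T → V → E) :
    avg μ L (fun t v => (a * U t v) • f t v) t v
      = (a * avg μ L U t v) • tilt μ L U f t v := by
  simp only [tilt, smul_smul, mul_inv_cancel_right₀ hU]
  simp only [avg, mul_smul, integral_smul]

namespace SmoothPath

variable [BorelSpace Z] [SecondCountableTopology Z] {S : Set ℝ} {L L' : ℝ → Z →L[ℝ] V}
  {U : ℝ → V → ℝ} {f g : ℝ → V → E}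

lemma tilt_sub (hL : SmoothPath S L L') (hμ : FiniteExpMoments μ) (hU : ExpGrowth S U)
    (hf : ExpGrowth S f) (hg : ExpGrowth S g) {t : ℝ} (ht : t ∈ S) (v : V) :
    tilt μ L U (fun t v => f t v - g t v) t v = tilt μ L U f t v - tilt μ L U g t v := by
  simp only [tilt, ← smul_sub]
  congr 1
  simp only [avg, smul_sub]
  exact integral_sub (hL.integrable hμ (hU.smul hf) ht v) (hL.integrable hμ (hU.smul hg) ht v)

lemma tilt_sum (hL : SmoothPath S L L') (hμ : FiniteExpMoments μ) (hU : ExpGrowth S U)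
    {ι : Type*} {s : Finset ι} {f : ι → ℝ → V → E} (hf : ∀ i ∈ s, ExpGrowth S (f i)) {t : ℝ}
    (ht : t ∈ S) (v : V) :
    tilt μ L U (fun t v => ∑ i ∈ s, f i t v) t v = ∑ i ∈ s, tilt μ L U (f i) t v := by
  simp only [tilt, ← Finset.smul_sum]
  congr 1
  simp only [avg, Finset.smul_sum]
  exact integral_finsetSum _ fun i hi => hL.integrable hμ (hU.smul (hf i hi)) ht v

lemma tilt_clm [CompleteSpace E] [CompleteSpace F] (hL : SmoothPath S L L')
    (hμ : FiniteExpMoments μ) (hU : ExpGrowth S U) (M : E →L[ℝ] F) (hf : ExpGrowth S f) {t : ℝ}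
    (ht : t ∈ S) (v : V) :
    tilt μ L U (fun t v => M (f t v)) t v = M (tilt μ L U f t v) := by
  simp only [tilt, map_smul, ← hL.avg_clm hμ M (hU.smul hf) ht v]

lemma growth_tilt [IsProbabilityMeasure μ] (hL : SmoothPath S L L') (hμ : FiniteExpMoments μ)
    (hU : PosExpGrowth S U) (hf : ExpGrowth S f) : ExpGrowth S (tilt μ L U f) :=
  (hL.posExpGrowth_avg hμ hU).growth_inv.smul (hL.growth_avg hμ (hU.growth.smul hf))

end SmoothPath

end Tilt

variable {V : Type*} [NormedAddCommGroup V] [NormedSpace ℝ V] {S : Set ℝ}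

lemma ExpGrowth.smulRight {T U E : Type*} [NormedAddCommGroup U] [NormedAddCommGroup E]
    [NormedSpace ℝ E] {S : Set T} {D : T → U → V →L[ℝ] ℝ} {e : T → U → E}
    (hD : ExpGrowth S D) (he : ExpGrowth S e) :
    ExpGrowth S fun t u => (D t u).smulRight (e t u) :=
  hD.bilin (ContinuousLinearMap.smulRightL ℝ V E) he

lemma smul_timeSpaceDeriv (a h : ℝ) (D : V →L[ℝ] ℝ) :
    a • timeSpaceDeriv h D = timeSpaceDeriv (a • h) (a • D) := by
  refine ContinuousLinearMap.ext fun w => ?_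
  simp only [smul_apply, timeSpaceDeriv_apply, smul_eq_mul]
  ring

/-- `W` is positive, with time derivative `c W h`, gradient `c W D` and Hessian `c W Q`. For
`c ≠ 0` the first two say that `c⁻¹ log W` has time derivative `h` and gradient `D`; its Hessian
is `Q - c D ⊗ D`. The normalization of `Q` is the one that commutes with averaging. -/
structure IsLogJet (S : Set ℝ) (c : ℝ) (W h : ℝ → V → ℝ) (D : ℝ → V → V →L[ℝ] ℝ)
    (Q : ℝ → V → V →L[ℝ] V →L[ℝ] ℝ) : Prop where
  posGrowth : PosExpGrowth S W
  growth_time : ExpGrowth S h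
  growth_grad : ExpGrowth S D
  growth_hess : ExpGrowth S Q
  hasFDerivAt : ∀ t ∈ S, ∀ v, HasFDerivAt (fun w : ℝ × V => W w.1 w.2)
    ((c * W t v) • timeSpaceDeriv (h t v) (D t v)) (t, v)
  hasFDerivAt_grad : ∀ t ∈ S, ∀ v,
    HasFDerivAt (fun v => (c * W t v) • D t v) ((c * W t v) • Q t v) v

namespace IsLogJet

variable {c : ℝ} {W h : ℝ → V → ℝ} {D : ℝ → V → V →L[ℝ] ℝ} {Q : ℝ → V → V →L[ℝ] V →L[ℝ] ℝ}

lemma hasFDerivAt_space (hW : IsLogJet S c W h D Q) {t : ℝ} (ht : t ∈ S) (v : V) :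
    HasFDerivAt (W t) ((c * W t v) • D t v) v := by
  refine ((hW.hasFDerivAt t ht v).comp v (hasFDerivAt_prodMk_right t v)).congr_fderiv ?_
  ext w
  simp [timeSpaceDeriv_apply]

lemma rpow (hW : IsLogJet S c W h D Q) (hc : c ≠ 0) (c' : ℝ) :
    IsLogJet S c' (fun t v => W t v ^ (c' / c)) h D
      (fun t v => Q t v - (c - c') • (D t v).smulRight (D t v)) where
  posGrowth := hW.posGrowth.rpow _
  growth_time := hW.growth_time
  growth_grad := hW.growth_grad
  growth_hess := hW.growth_hess.sub <| (ExpGrowth.const S _).smul <|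
    hW.growth_grad.smulRight hW.growth_grad
  hasFDerivAt t ht v := by
    have hpos := (hW.posGrowth.pos t ht v).ne'
    refine ((hW.hasFDerivAt t ht v).rpow_const (p := c' / c) (.inl hpos)).congr_fderiv ?_
    rw [smul_smul, Real.rpow_sub_one hpos]
    congr 1
    field_simp
  hasFDerivAt_grad t ht v := by
    have hpos (v : V) : W t v ≠ 0 := (hW.posGrowth.pos t ht v).ne'
    have h_split : (fun v => (c' * W t v ^ (c' / c)) • D t v)
        = fun v => (c' / c * W t v ^ (c' / c - 1)) • (c * W t v) • D t v := by
      funext v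
      rw [smul_smul, Real.rpow_sub_one (hpos v)]
      congr 1
      have := hpos v
      field_simp
    rw [h_split]
    refine ((((hW.hasFDerivAt_space ht v).rpow_const (p := c' / c - 1)
      (.inl (hpos v))).const_mul (c' / c)).smul (hW.hasFDerivAt_grad t ht v)).congr_fderiv ?_
    ext w u
    have := hpos v
    simp only [Real.rpow_sub_one (hpos v), add_apply, sub_apply, smul_apply, smul_eq_mul,
      ContinuousLinearMap.smulRight_apply]
    field_simp
    ring

lemma isJet (hW : IsLogJet S c W h D Q) :
    IsJet S W (fun t v => (c * W t v) • h t v) (fun t v => (c * W t v) • D t v)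
      (fun t v => (c * W t v) • Q t v) := by
  have growth_mul := (ExpGrowth.const S c).mul hW.posGrowth.growth
  refine ⟨hW.posGrowth.growth, growth_mul.smul hW.growth_time, growth_mul.smul hW.growth_grad,
    growth_mul.smul hW.growth_hess, fun t ht v => ?_, hW.hasFDerivAt_grad⟩
  rw [← smul_timeSpaceDeriv]
  exact hW.hasFDerivAt t ht v

lemma isJet_log (hW : IsLogJet S c W h D Q) (hc : c ≠ 0) :
    IsJet S (fun t v => c⁻¹ * Real.log (W t v)) h D
      (fun t v => Q t v - c • (D t v).smulRight (D t v)) where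
  growth := (ExpGrowth.const S c⁻¹).mul hW.posGrowth.growth_log
  growth_time := hW.growth_time
  growth_grad := hW.growth_grad
  growth_hess := hW.growth_hess.sub <| (ExpGrowth.const S _).smul <|
    hW.growth_grad.smulRight hW.growth_grad
  hasFDerivAt t ht v := by
    have hpos := (hW.posGrowth.pos t ht v).ne'
    refine (((hW.hasFDerivAt t ht v).log hpos).const_mul c⁻¹).congr_fderiv ?_
    rw [smul_smul, smul_smul]
    convert one_smul ℝ _
    field_simp
  hasFDerivAt_grad t ht v := by
    have hpos (v : V) : W t v ≠ 0 := (hW.posGrowth.pos t ht v).ne'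
    have h_split : D t = fun v => (c * W t v)⁻¹ • (c * W t v) • D t v :=
      funext fun v => (inv_smul_smul₀ (mul_ne_zero hc (hpos v)) _).symm
    rw [h_split]
    refine (((hasDerivAt_inv (mul_ne_zero hc (hpos v))).comp_hasFDerivAt v
      ((hW.hasFDerivAt_space ht v).const_mul c)).smul
      (hW.hasFDerivAt_grad t ht v)).congr_fderiv ?_
    ext w u
    have := hpos v
    simp only [add_apply, sub_apply, smul_apply, smul_eq_mul, Function.comp_apply,
      ContinuousLinearMap.smulRight_apply]
    field_simp
    ring

lemma avg {J : Type*} [Fintype J] [DecidableEq J] {L L' : ℝ → (J → ℝ) →L[ℝ] V}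
    (hW : IsLogJet S c W h D Q) (hL : SmoothPath S L L') (σ : J → NNReal) :
    IsLogJet S c (avg (gaussPi σ) L W)
      (fun t v => tilt (gaussPi σ) L W h t v
        + covForm σ (L t) (L' t) (tilt (gaussPi σ) L W Q t v))
      (tilt (gaussPi σ) L W D) (tilt (gaussPi σ) L W Q) := by
  have hσ := finiteExpMoments_gaussPi σ
  have h_jet := hW.isJet.avg hL (σ := σ)
  have growth_hess := hL.growth_tilt hσ hW.posGrowth hW.growth_hess
  have hpos (t : ℝ) (ht : t ∈ S) (v : V) : GaussianInterpolation.avg (gaussPi σ) L W t v ≠ 0 :=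
    (hL.avg_pos hσ hW.posGrowth ht v).ne'
  refine ⟨hL.posExpGrowth_avg hσ hW.posGrowth,
    (hL.growth_tilt hσ hW.posGrowth hW.growth_time).add (hL.growth_covForm growth_hess),
    hL.growth_tilt hσ hW.posGrowth hW.growth_grad, growth_hess, fun t ht v => ?_,
    fun t ht v => ?_⟩
  · rw [smul_timeSpaceDeriv, smul_add, ← map_smul]
    simpa only [avg_mul_smul (hpos t ht v)] using h_jet.hasFDerivAt t ht v
  · simpa only [funext fun v => avg_mul_smul (hpos t ht v) c D,
      avg_mul_smul (hpos t ht v)] using h_jet.hasFDerivAt_grad t ht v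

end IsLogJet

end LogJets

section Tower

variable {V E : Type*} [NormedAddCommGroup V] [NormedSpace ℝ V] [NormedAddCommGroup E]
  [NormedSpace ℝ E]

section Chains

variable {T Z : Type*} [NormedAddCommGroup Z] [NormedSpace ℝ Z] [MeasurableSpace Z]

/-- Iterated averages of powers of `W₀`, with successive exponents `c (k + 1) / c k`. -/
def tower (μ : ℕ → Measure Z) (L : T → Z →L[ℝ] V) (c : ℕ → ℝ) (W₀ : T → V → ℝ) : ℕ → T → V → ℝ
  | 0 => W₀
  | k + 1 => avg (μ (k + 1)) L fun t v => tower μ L c W₀ k t v ^ (c (k + 1) / c k)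

/-- The reweighted average over the layer `k + 1` of the tower. -/
def tiltStep (μ : ℕ → Measure Z) (L : T → Z →L[ℝ] V) (c : ℕ → ℝ) (W₀ : T → V → ℝ) (k : ℕ)
    (f : T → V → E) : T → V → E :=
  tilt (μ (k + 1)) L (fun t v => tower μ L c W₀ k t v ^ (c (k + 1) / c k)) f

/-- The successive reweighted averages over the layers `b`, …, `k` of the tower. -/
def tiltChain (μ : ℕ → Measure Z) (L : T → Z →L[ℝ] V) (c : ℕ → ℝ) (W₀ : T → V → ℝ) (b : ℕ) :
    ℕ → (T → V → E) → T → V → E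
  | 0, f => f
  | k + 1, f => if b ≤ k + 1 then tiltStep μ L c W₀ k (tiltChain μ L c W₀ b k f) else f

/-- The contribution of two replicas that share the layers above `b` and are independent below, for
the covariance functional `K b` and the gradient `D` of the logarithm of `W₀`. -/
def overlap (μ : ℕ → Measure Z) (L : T → Z →L[ℝ] V) (c : ℕ → ℝ) (W₀ : T → V → ℝ)
    (K : ℕ → (V →L[ℝ] V →L[ℝ] ℝ) →L[ℝ] ℝ) (D : T → V → V →L[ℝ] ℝ) (b : ℕ) (t : T) (v : V) : ℝ :=
  (c b - c (b + 1))
    * K b ((tiltChain μ L c W₀ 1 b D t v).smulRight (tiltChain μ L c W₀ 1 b D t v))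

/-- The time derivative of the logarithm of the tower at height `k`, up to the Hessian term that
the layers above `k` compensate; `ρ` is its value at the bottom. -/
def drift (μ : ℕ → Measure Z) (L : T → Z →L[ℝ] V) (c : ℕ → ℝ) (W₀ : T → V → ℝ)
    (K : ℕ → (V →L[ℝ] V →L[ℝ] ℝ) →L[ℝ] ℝ) (D : T → V → V →L[ℝ] ℝ) (ρ : T → V → ℝ) (k : ℕ)
    (t : T) (v : V) : ℝ :=
  tiltChain μ L c W₀ 1 k ρ t v
    - ∑ b ∈ Finset.Icc 1 k, tiltChain μ L c W₀ b k (overlap μ L c W₀ K D (b - 1)) t v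

variable {μ : ℕ → Measure Z} {L : T → Z →L[ℝ] V} {c : ℕ → ℝ} {W₀ : T → V → ℝ}
  {K : ℕ → (V →L[ℝ] V →L[ℝ] ℝ) →L[ℝ] ℝ} {D : T → V → V →L[ℝ] ℝ} {ρ : T → V → ℝ}

lemma tiltChain_of_lt {b k : ℕ} (h : k < b) (f : T → V → E) : tiltChain μ L c W₀ b k f = f := by
  cases k with
  | zero => rfl
  | succ k => rw [tiltChain, if_neg (by omega)]

lemma tiltChain_succ {b k : ℕ} (h : b ≤ k + 1) (f : T → V → E) :
    tiltChain μ L c W₀ b (k + 1) f = tiltStep μ L c W₀ k (tiltChain μ L c W₀ b k f) := by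
  rw [tiltChain, if_pos h]

lemma tiltChain_congr {b k : ℕ} {f g : T → V → E} {t : T} (h : ∀ v, f t v = g t v) {v : V} :
    tiltChain μ L c W₀ b k f t v = tiltChain μ L c W₀ b k g t v := by
  induction k generalizing v with
  | zero => exact h v
  | succ k ih =>
    rw [tiltChain, tiltChain]
    split_ifs
    · simp only [tiltStep, tilt, avg, ih]
    · exact h v

lemma drift_sub_overlap (k : ℕ) (t : T) (v : V) :
    drift μ L c W₀ K D ρ k t v - overlap μ L c W₀ K D k t v
      = tiltChain μ L c W₀ 1 k ρ t v - ∑ b ∈ Finset.Icc 1 (k + 1),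
          tiltChain μ L c W₀ b k (overlap μ L c W₀ K D (b - 1)) t v := by
  rw [drift, Finset.sum_Icc_succ_top (by omega), tiltChain_of_lt k.lt_succ_self,
    Nat.add_sub_cancel, sub_sub]

end Chains

section Growth

variable {Z : Type*} [NormedAddCommGroup Z] [NormedSpace ℝ Z] [MeasurableSpace Z] [BorelSpace Z]
  [SecondCountableTopology Z] {S : Set ℝ} {L L' : ℝ → Z →L[ℝ] V} {μ : ℕ → Measure Z}
  [∀ k, IsProbabilityMeasure (μ k)] {c : ℕ → ℝ} {W₀ : ℝ → V → ℝ}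
  {K : ℕ → (V →L[ℝ] V →L[ℝ] ℝ) →L[ℝ] ℝ} {D : ℝ → V → V →L[ℝ] ℝ} {ρ : ℝ → V → ℝ}

namespace SmoothPath

lemma posExpGrowth_tower (hL : SmoothPath S L L') (hμ : ∀ k, FiniteExpMoments (μ k))
    (hW : PosExpGrowth S W₀) (k : ℕ) : PosExpGrowth S (tower μ L c W₀ k) := by
  induction k with
  | zero => exact hW
  | succ k ih => exact hL.posExpGrowth_avg (hμ _) (ih.rpow _)

lemma growth_tiltChain (hL : SmoothPath S L L') (hμ : ∀ k, FiniteExpMoments (μ k))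
    (hW : PosExpGrowth S W₀) (b k : ℕ) {f : ℝ → V → E} (hf : ExpGrowth S f) :
    ExpGrowth S (tiltChain μ L c W₀ b k f) := by
  induction k with
  | zero => exact hf
  | succ k ih =>
    rw [tiltChain]
    split_ifs
    · exact hL.growth_tilt (hμ _) ((hL.posExpGrowth_tower hμ hW k).rpow _) ih
    · exact hf

lemma tiltChain_sum_smul [CompleteSpace E] (hL : SmoothPath S L L')
    (hμ : ∀ k, FiniteExpMoments (μ k)) (hW : PosExpGrowth S W₀) (b k : ℕ) {ι : Type*}
    {s : Finset ι} {f : ι → ℝ → V → ℝ} (hf : ∀ i ∈ s, ExpGrowth S (f i)) (e : ι → E) {t : ℝ}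
    (ht : t ∈ S) (v : V) :
    tiltChain μ L c W₀ b k (fun t v => ∑ i ∈ s, f i t v • e i) t v
      = ∑ i ∈ s, tiltChain μ L c W₀ b k (f i) t v • e i := by
  induction k generalizing v with
  | zero => rfl
  | succ k ih =>
    simp only [tiltChain]
    split_ifs
    · have hU := ((hL.posExpGrowth_tower (c := c) hμ hW k).rpow (c (k + 1) / c k)).growth
      have growth_chain : ∀ i ∈ s, ExpGrowth S (tiltChain μ L c W₀ b k (f i)) :=
        fun i hi => hL.growth_tiltChain hμ hW b k (hf i hi)
      let toE (i : ι) : ℝ →L[ℝ] E := (ContinuousLinearMap.id ℝ ℝ).smulRight (e i)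
      calc tiltStep μ L c W₀ k (tiltChain μ L c W₀ b k fun t v => ∑ i ∈ s, f i t v • e i) t v
          = tiltStep μ L c W₀ k
              (fun t v => ∑ i ∈ s, toE i (tiltChain μ L c W₀ b k (f i) t v)) t v := by
            simp only [tiltStep, tilt, avg, ih, toE, ContinuousLinearMap.smulRight_apply,
              ContinuousLinearMap.id_apply]
        _ = ∑ i ∈ s, tiltStep μ L c W₀ k
              (fun t v => toE i (tiltChain μ L c W₀ b k (f i) t v)) t v :=
            hL.tilt_sum (hμ _) hU (fun i hi => (growth_chain i hi).clm (toE i)) ht v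
        _ = ∑ i ∈ s, tiltStep μ L c W₀ k (tiltChain μ L c W₀ b k (f i)) t v • e i :=
            Finset.sum_congr rfl fun i hi =>
              hL.tilt_clm (hμ _) hU (toE i) (growth_chain i hi) ht v
    · rfl

lemma growth_overlap (hL : SmoothPath S L L') (hμ : ∀ k, FiniteExpMoments (μ k))
    (hW : PosExpGrowth S W₀) (hD : ExpGrowth S D) (b : ℕ) :
    ExpGrowth S (overlap μ L c W₀ K D b) :=
  have hDb := hL.growth_tiltChain hμ hW (c := c) 1 b hD
  (ExpGrowth.const S _).mul ((hDb.smulRight hDb).clm (K b))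

lemma growth_drift (hL : SmoothPath S L L') (hμ : ∀ k, FiniteExpMoments (μ k))
    (hW : PosExpGrowth S W₀) (hD : ExpGrowth S D) (hρ : ExpGrowth S ρ) (k : ℕ) :
    ExpGrowth S (drift μ L c W₀ K D ρ k) :=
  (hL.growth_tiltChain hμ hW 1 k hρ).sub <|
    .sum fun b _ => hL.growth_tiltChain hμ hW b k (hL.growth_overlap hμ hW hD (b - 1))

lemma drift_succ (hL : SmoothPath S L L') (hμ : ∀ k, FiniteExpMoments (μ k))
    (hW : PosExpGrowth S W₀) (hD : ExpGrowth S D) (hρ : ExpGrowth S ρ) (k : ℕ) {t : ℝ}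
    (ht : t ∈ S) (v : V) :
    drift μ L c W₀ K D ρ (k + 1) t v = tiltStep μ L c W₀ k
      (fun t v => drift μ L c W₀ K D ρ k t v - overlap μ L c W₀ K D k t v) t v := by
  have hU := ((hL.posExpGrowth_tower (c := c) hμ hW k).rpow (c (k + 1) / c k)).growth
  have growth_layer : ∀ b ∈ Finset.Icc 1 (k + 1),
      ExpGrowth S (tiltChain μ L c W₀ b k (overlap μ L c W₀ K D (b - 1))) :=
    fun b _ => hL.growth_tiltChain hμ hW b k (hL.growth_overlap hμ hW hD (b - 1))
  simp only [drift_sub_overlap]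
  rw [tiltStep, hL.tilt_sub (hμ _) hU (hL.growth_tiltChain hμ hW 1 k hρ) (.sum growth_layer) ht,
    hL.tilt_sum (hμ _) hU growth_layer ht, drift, tiltChain_succ (by omega)]
  congr 1
  exact Finset.sum_congr rfl fun b hb => by rw [tiltChain_succ (Finset.mem_Icc.1 hb).2]; rfl

lemma tiltStep_drift_sub_add (hL : SmoothPath S L L') (hμ : ∀ k, FiniteExpMoments (μ k))
    (hW : PosExpGrowth S W₀) (hD : ExpGrowth S D) (hρ : ExpGrowth S ρ) (k : ℕ)
    {Q : ℝ → V → V →L[ℝ] V →L[ℝ] ℝ} (hQ : ExpGrowth S Q) {t : ℝ} (ht : t ∈ S) (v : V) :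
    let Dₖ := tiltChain μ L c W₀ 1 k D
    let Q' := tiltStep μ L c W₀ k
      (fun t v => Q t v - (c k - c (k + 1)) • (Dₖ t v).smulRight (Dₖ t v))
    tiltStep μ L c W₀ k (fun t v => drift μ L c W₀ K D ρ k t v - K k (Q t v)) t v
        + (K k - K (k + 1)) (Q' t v)
      = drift μ L c W₀ K D ρ (k + 1) t v - K (k + 1) (Q' t v) := by
  intro Dₖ Q'
  have hU := ((hL.posExpGrowth_tower (c := c) hμ hW k).rpow (c (k + 1) / c k)).growth
  have growth_grad : ExpGrowth S Dₖ := hL.growth_tiltChain hμ hW 1 k hD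
  have growth_hess := hQ.sub <|
    (ExpGrowth.const S (c k - c (k + 1))).smul (growth_grad.smulRight growth_grad)
  have growth_time := (hL.growth_drift (c := c) (K := K) hμ hW hD hρ k).sub
    (hL.growth_overlap (c := c) (K := K) hμ hW hD k)
  rw [hL.drift_succ hμ hW hD hρ k ht v, sub_apply, ← add_sub_assoc, sub_left_inj,
    ← eq_sub_iff_add_eq]
  simp only [Q', tiltStep]
  rw [← hL.tilt_clm (hμ _) hU (K k) growth_hess ht v,
    ← hL.tilt_sub (hμ _) hU growth_time (growth_hess.clm (K k)) ht v]
  simp only [map_sub, map_smul, smul_eq_mul, overlap, Dₖ, sub_sub_sub_cancel_right]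

end SmoothPath

end Growth

section Derivative

variable {J : Type*} [Fintype J] [DecidableEq J] {S : Set ℝ} {L L' : ℝ → (J → ℝ) →L[ℝ] V}
  {σ : ℕ → J → NNReal} {c : ℕ → ℝ} {W₀ h₀ : ℝ → V → ℝ} {D₀ : ℝ → V → V →L[ℝ] ℝ}
  {Q₀ : ℝ → V → V →L[ℝ] V →L[ℝ] ℝ} {K : ℕ → (V →L[ℝ] V →L[ℝ] ℝ) →L[ℝ] ℝ} {r : ℕ}

theorem SmoothPath.isLogJet_tower (hL : SmoothPath S L L') (hc : ∀ k ≤ r, c k ≠ 0)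
    (hK : ∀ k < r, ∀ t ∈ S, covForm (σ (k + 1)) (L t) (L' t) = K k - K (k + 1))
    (hW : IsLogJet S (c 0) W₀ h₀ D₀ Q₀) {k : ℕ} (hk : k ≤ r) :
    ∃ Q, IsLogJet S (c k) (tower (fun k => gaussPi (σ k)) L c W₀ k)
      (fun t v => drift (fun k => gaussPi (σ k)) L c W₀ K D₀
        (fun t v => h₀ t v + K 0 (Q₀ t v)) k t v - K k (Q t v))
      (tiltChain (fun k => gaussPi (σ k)) L c W₀ 1 k D₀) Q := by
  have hσ (k : ℕ) : FiniteExpMoments (gaussPi (σ k)) := finiteExpMoments_gaussPi _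
  have hρ : ExpGrowth S fun t v => h₀ t v + K 0 (Q₀ t v) :=
    hW.growth_time.add (hW.growth_hess.clm _)
  induction k with
  | zero => exact ⟨Q₀, by simpa [drift, tiltChain, tower] using hW⟩
  | succ k ih =>
    obtain ⟨Q, hQ⟩ := ih (by omega)
    have h_step := (hQ.rpow (hc k (by omega)) (c (k + 1))).avg hL (σ (k + 1))
    rw [tiltChain_succ (by omega)]
    refine ⟨_, { h_step with growth_time := ?_, hasFDerivAt := fun t ht v => ?_ }⟩
    · exact (hL.growth_drift hσ hW.posGrowth hW.growth_grad hρ _).sub (h_step.growth_hess.clm _)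
    · have time_eq := hL.tiltStep_drift_sub_add (c := c) (K := K) hσ hW.posGrowth hW.growth_grad
        hρ k hQ.growth_hess ht v
      rw [← hK k hk t ht] at time_eq
      exact (h_step.hasFDerivAt t ht v).congr_fderiv
        (congrArg (fun h => (_ : ℝ) • timeSpaceDeriv h _) time_eq)

variable {J' : Type*} [Fintype J'] [DecidableEq J'] {σ' : J' → NNReal}
  {M M' : ℝ → (J' → ℝ) →L[ℝ] V}

theorem SmoothPath.hasDerivAt_avg_log_tower (hL : SmoothPath S L L') (hM : SmoothPath S M M')
    (hc : ∀ k ≤ r, c k ≠ 0) (hcr : c (r + 1) = 0)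
    (hK : ∀ k < r, ∀ t ∈ S, covForm (σ (k + 1)) (L t) (L' t) = K k - K (k + 1))
    (hKr : ∀ t ∈ S, covForm σ' (M t) (M' t) = K r)
    (hW : IsLogJet S (c 0) W₀ h₀ D₀ Q₀) {t : ℝ} (ht : t ∈ S) (v : V) :
    HasDerivAt (fun τ => avg (gaussPi σ') M (fun t v =>
        (c r)⁻¹ * Real.log (tower (fun k => gaussPi (σ k)) L c W₀ r t v)) τ v)
      (avg (gaussPi σ') M (fun t v =>
        drift (fun k => gaussPi (σ k)) L c W₀ K D₀ (fun t v => h₀ t v + K 0 (Q₀ t v)) r t v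
          - overlap (fun k => gaussPi (σ k)) L c W₀ K D₀ r t v) t v) t := by
  obtain ⟨Q, hQ⟩ := hL.isLogJet_tower hc hK hW le_rfl
  have h_jet := hQ.isJet_log (hc r le_rfl)
  refine ((h_jet.avg hM).hasDerivAt ht v).congr_deriv ?_
  have hσ' := finiteExpMoments_gaussPi σ'
  rw [hKr t ht, ← hM.avg_clm hσ' (K r) h_jet.growth_hess ht v,
    ← hM.avg_add hσ' h_jet.growth_time (h_jet.growth_hess.clm (K r)) ht v]
  simp only [map_sub, map_smul, smul_eq_mul, overlap, hcr, sub_zero, sub_add_sub_cancel]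

end Derivative

end Tower

section NoiseMap

variable {J : Type*} [Fintype J]

/-- The noise `z ↦ ∑ j, a j t * z j • w j` with directions `w` and time dependent amplitudes `a`. -/
def noiseMap {V : Type*} [NormedAddCommGroup V] [NormedSpace ℝ V] (a : J → ℝ → ℝ) (w : J → V)
    (t : ℝ) : (J → ℝ) →L[ℝ] V :=
  ∑ j, a j t • (ContinuousLinearMap.proj j : (J → ℝ) →L[ℝ] ℝ).smulRight (w j)

section Directions

variable {V : Type*} [NormedAddCommGroup V] [NormedSpace ℝ V]

lemma noiseMap_apply (a : J → ℝ → ℝ) (w : J → V) (t : ℝ) (z : J → ℝ) :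
    noiseMap a w t z = ∑ j, (a j t * z j) • w j := by
  simp [noiseMap, sum_apply, mul_smul]

lemma noiseMap_single [DecidableEq J] (a : J → ℝ → ℝ) (w : J → V) (t : ℝ) (j : J) :
    noiseMap a w t (Pi.single j 1) = a j t • w j := by
  simp [noiseMap_apply, Pi.single_apply]

lemma smoothPath_noiseMap {S : Set ℝ} (hS : IsOpen S) {a a' : J → ℝ → ℝ}
    (ha : ∀ j, ∀ t ∈ S, HasDerivAt (a j) (a' j t) t) {K : ℝ} (hK : 0 ≤ K)
    (hbdd : ∀ j, ∀ t ∈ S, |a j t| ≤ K ∧ |a' j t| ≤ K) (w : J → V) :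
    SmoothPath S (noiseMap a w) (noiseMap a' w) where
  isOpen := hS
  hasDerivAt t ht := HasDerivAt.fun_sum fun j _ => (ha j t ht).smul_const _
  bdd := by
    have norm_le {b : J → ℝ → ℝ} {t : ℝ} (hb : ∀ j, |b j t| ≤ K) : ‖noiseMap b w t‖
        ≤ ∑ j, K * ‖(ContinuousLinearMap.proj j : (J → ℝ) →L[ℝ] ℝ).smulRight (w j)‖ :=
      norm_sum_le_of_le _ fun j _ => by
        rw [norm_smul]
        exact mul_le_mul_of_nonneg_right (hb j) (norm_nonneg _)
    exact ⟨_, Finset.sum_nonneg fun j _ => mul_nonneg hK (norm_nonneg _), fun t ht =>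
      ⟨norm_le fun j => (hbdd j t ht).1, norm_le fun j => (hbdd j t ht).2⟩⟩

end Directions

variable {ι : Type*} [Fintype ι] [DecidableEq ι]

/-- The functional `Q ↦ ∑ i j, κ i j * Q eᵢ eⱼ` on bilinear forms. -/
def kernelForm (κ : ι → ι → ℝ) : ((ι → ℝ) →L[ℝ] (ι → ℝ) →L[ℝ] ℝ) →L[ℝ] ℝ :=
  ∑ i, ∑ j, κ i j • (ContinuousLinearMap.apply ℝ ℝ (Pi.single j 1)
    ∘L ContinuousLinearMap.apply ℝ ((ι → ℝ) →L[ℝ] ℝ) (Pi.single i 1))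

lemma kernelForm_apply (κ : ι → ι → ℝ) (Q : (ι → ℝ) →L[ℝ] (ι → ℝ) →L[ℝ] ℝ) :
    kernelForm κ Q = ∑ i, ∑ j, κ i j * Q (Pi.single i 1) (Pi.single j 1) := by
  simp [kernelForm, sum_apply]

lemma kernelForm_smulRight (κ : ι → ι → ℝ) (A B : (ι → ℝ) →L[ℝ] ℝ) :
    kernelForm κ (A.smulRight B) = ∑ i, ∑ j, κ i j * (A (Pi.single i 1) * B (Pi.single j 1)) := by
  simp [kernelForm_apply]

lemma kernelForm_smulRight_proj (κ : ι → ι → ℝ) (i j : ι) :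
    kernelForm κ ((ContinuousLinearMap.proj i).smulRight (ContinuousLinearMap.proj j)) = κ i j := by
  simp [kernelForm_smulRight, Pi.single_apply]

lemma kernelForm_sub (κ κ' : ι → ι → ℝ) :
    kernelForm (fun i j => κ i j - κ' i j) = kernelForm κ - kernelForm κ' := by
  simp only [kernelForm, sub_smul, Finset.sum_sub_distrib]

lemma covForm_noiseMap [DecidableEq J] (σ : J → NNReal) (a a' : J → ℝ → ℝ) (w : J → ι → ℝ)
    (t : ℝ) :
    covForm σ (noiseMap a w t) (noiseMap a' w t)
      = kernelForm fun i i' => ∑ j, σ j * (a j t * a' j t) * (w j i * w j i') := by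
  refine ContinuousLinearMap.ext fun Q => ?_
  have expand (u : ι → ℝ) :
      Q u u = ∑ i, ∑ i', u i * u i' * Q (Pi.single i 1) (Pi.single i' 1) := by
    conv_lhs => rw [pi_eq_sum_univ' u]
    simp only [map_sum, map_smul, sum_apply, smul_apply, smul_eq_mul, Finset.mul_sum, mul_assoc]
    rw [Finset.sum_comm]
    exact Finset.sum_congr rfl fun i _ => Finset.sum_congr rfl fun i' _ => mul_left_comm _ _ _
  simp only [covForm_apply, kernelForm_apply, noiseMap_single, map_smul, smul_apply, smul_eq_mul,
    expand, Finset.mul_sum, Finset.sum_mul]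
  rw [Finset.sum_comm]
  refine Finset.sum_congr rfl fun i _ => ?_
  rw [Finset.sum_comm]
  exact Finset.sum_congr rfl fun i' _ => Finset.sum_congr rfl fun j _ => by ring

end NoiseMap

end GaussianInterpolation

namespace FullLifting

open MeasureTheory ProbabilityTheory Filter Topology GaussianInterpolation

section Laws

variable {m n : ℕ}

instance (d : ℕ) (v : ℝ) : IsProbabilityMeasure (gaussVec d v) := by
  unfold gaussVec; infer_instance

instance (p q : ℕ → ℝ) (k : ℕ) : IsProbabilityMeasure (layerLaw m n p q k) := by
  unfold layerLaw; infer_instance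

/-- The components of a layer: that of `u⁽⁴⁾`, those of `u⁽²⁾` and those of `h`. -/
abbrev LayerIndex (m n : ℕ) : Type := Unit ⊕ Fin m ⊕ Fin n

/-- The components of the outermost noise: the entries of `G` and the components of a layer. -/
abbrev OuterIndex (m n : ℕ) : Type := (Fin m × Fin n) ⊕ LayerIndex m n

/-- The variances of the components of the layer `k`. -/
def layerVar (m n : ℕ) (p q : ℕ → ℝ) (k : ℕ) : LayerIndex m n → NNReal :=
  Sum.elim (fun _ => (p (k - 1) * q (k - 1) - p k * q k).toNNReal)
    (Sum.elim (fun _ => (p (k - 1) - p k).toNNReal) (fun _ => (q (k - 1) - q k).toNNReal))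

/-- The variances of the entries of `G` and of the components of the layer `k`. -/
def outerVar (m n : ℕ) (p q : ℕ → ℝ) (k : ℕ) : OuterIndex m n → NNReal :=
  Sum.elim (fun _ => 1) (layerVar m n p q k)

/-- A layer as one vector. -/
def layerEquiv : Layer m n ≃ᵐ (LayerIndex m n → ℝ) :=
  ((MeasurableEquiv.funUnique Unit ℝ).symm.prodCongr
    (MeasurableEquiv.sumPiEquivProdPi fun _ : Fin m ⊕ Fin n => ℝ).symm).trans
      (MeasurableEquiv.sumPiEquivProdPi fun _ : LayerIndex m n => ℝ).symm

/-- The matrix `G` and a layer as one vector. -/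
def outerEquiv : (Fin m → Fin n → ℝ) × Layer m n ≃ᵐ (OuterIndex m n → ℝ) :=
  ((MeasurableEquiv.curry (Fin m) (Fin n) ℝ).symm.prodCongr layerEquiv).trans
    (MeasurableEquiv.sumPiEquivProdPi fun _ : OuterIndex m n => ℝ).symm

lemma layerEquiv_apply (u : Layer m n) :
    layerEquiv u = Sum.elim (fun _ => u.1) (Sum.elim u.2.1 u.2.2) := by
  ext (_ | _ | _) <;> rfl

lemma outerEquiv_apply (z : (Fin m → Fin n → ℝ) × Layer m n) :
    outerEquiv z = Sum.elim (fun j => z.1 j.1 j.2) (layerEquiv z.2) := by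
  ext (_ | _) <;> rfl

lemma measurePreserving_layerEquiv (p q : ℕ → ℝ) (k : ℕ) :
    MeasurePreserving layerEquiv (layerLaw m n p q k) (gaussPi (layerVar m n p q k)) :=
  (measurePreserving_sumPiEquivProdPi_symm _).comp
    ((measurePreserving_funUnique _ Unit).symm.prod (measurePreserving_sumPiEquivProdPi_symm
      fun j => gaussianReal 0 (layerVar m n p q k (Sum.inr j))))

lemma measurePreserving_curry_symm {I J X : Type*} [Fintype I] [Fintype J] [MeasurableSpace X]
    (μ : Measure X) [SigmaFinite μ] :
    MeasurePreserving (MeasurableEquiv.curry I J X).symm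
      (Measure.pi fun _ => Measure.pi fun _ => μ) (Measure.pi fun _ => μ) := by
  refine ⟨MeasurableEquiv.measurable _, (Measure.pi_eq fun s _ => ?_).symm⟩
  have preimage_pi : (MeasurableEquiv.curry I J X).symm ⁻¹' Set.univ.pi s
      = Set.univ.pi fun i => Set.univ.pi fun j => s (i, j) := by
    ext G
    simp only [Set.mem_preimage, Set.mem_univ_pi, Prod.forall]
    rfl
  simp only [MeasurableEquiv.map_apply, preimage_pi, Measure.pi_pi, Fintype.prod_prod_type]

lemma measurePreserving_outerEquiv (p q : ℕ → ℝ) (k : ℕ) :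
    MeasurePreserving outerEquiv ((matLaw m n).prod (layerLaw m n p q k))
      (gaussPi (outerVar m n p q k)) :=
  (measurePreserving_sumPiEquivProdPi_symm fun j => gaussianReal 0 (outerVar m n p q k j)).comp
    ((measurePreserving_curry_symm _).prod (measurePreserving_layerEquiv p q k))

end Laws

section Field

variable {m n l : ℕ} (x : Fin l → EuclideanSpace ℝ (Fin n)) (y : Fin l → EuclideanSpace ℝ (Fin m))

/-- The time dependent amplitudes of the components of a layer in `D₀`. -/
def layerPhase : LayerIndex m n → ℝ → ℝ :=
  Sum.elim (fun _ t => √t) (fun _ t => √(1 - t))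

/-- The directions, in the space of configurations, of the components of a layer in `D₀`. -/
def layerWeight : LayerIndex m n → Fin l × Fin l → ℝ :=
  Sum.elim (fun _ i => ‖x i.1‖ * ‖y i.2‖)
    (Sum.elim (fun a i => ‖x i.1‖ * y i.2 a) (fun b i => ‖y i.2‖ * x i.1 b))

/-- The time dependent amplitudes of the entries of `G` and of the components of a layer. -/
def outerPhase : OuterIndex m n → ℝ → ℝ :=
  Sum.elim (fun _ t => √t) layerPhase

/-- The directions of the entries of `G` and of the components of a layer in `D₀`. -/
def outerWeight : OuterIndex m n → Fin l × Fin l → ℝ :=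
  Sum.elim (fun j i => y i.2 j.1 * x i.1 j.2) (layerWeight x y)

/-- The contribution of one layer to `D₀`. -/
def layerNoise : ℝ → (LayerIndex m n → ℝ) →L[ℝ] (Fin l × Fin l → ℝ) :=
  noiseMap layerPhase (layerWeight x y)

/-- The joint contribution of `G` and of one layer to `D₀`. -/
def outerNoise : ℝ → (OuterIndex m n → ℝ) →L[ℝ] (Fin l × Fin l → ℝ) :=
  noiseMap outerPhase (outerWeight x y)

/-- The part of `D₀` that depends on `G` and on the layers `k + 1`, …, `r + 1`. -/
def tailField (r : ℕ) (t : ℝ) (k : ℕ) (ω : Sample m n) : Fin l × Fin l → ℝ :=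
  (fun i => √t * ∑ a, ∑ b, y i.2 a * ω.1 a b * x i.1 b)
    + ∑ j ∈ Finset.Icc (k + 1) (r + 1), layerNoise x y t (layerEquiv (ω.2 j))

lemma layerNoise_layerEquiv (t : ℝ) (u : Layer m n) (i : Fin l × Fin l) :
    layerNoise x y t (layerEquiv u) i
      = √t * ‖x i.1‖ * ‖y i.2‖ * u.1
        + (√(1 - t) * ‖x i.1‖ * (∑ a, y i.2 a * u.2.1 a)
          + √(1 - t) * ‖y i.2‖ * (∑ b, u.2.2 b * x i.1 b)) := by
  simp only [layerNoise, noiseMap_apply, layerEquiv_apply, layerPhase, layerWeight,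
    Fintype.sum_sum_type, Sum.elim_inl, Sum.elim_inr, Finset.univ_unique, Finset.sum_singleton,
    Pi.smul_apply, Finset.sum_apply, smul_eq_mul, Finset.mul_sum]
  refine congrArg₂ _ (by ring) (congrArg₂ _ ?_ ?_) <;> exact Finset.sum_congr rfl fun _ _ => by ring

lemma D₀_eq_tailField (r : ℕ) (t : ℝ) (i₁ i₂ : Fin l) (ω : Sample m n) :
    D₀ r x y t i₁ i₂ ω = tailField x y r t 0 ω (i₁, i₂) := by
  simp only [D₀, tailField, Pi.add_apply, Finset.sum_apply, layerNoise_layerEquiv,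
    Finset.sum_add_distrib, zero_add, ← Finset.mul_sum, Finset.sum_mul]
  rw [Finset.sum_comm (s := Finset.Icc 1 (r + 1)), Finset.sum_comm (s := Finset.Icc 1 (r + 1))]
  simp only [← Finset.mul_sum]
  ring

lemma tailField_update {r k : ℕ} (hk : k ≤ r) (t : ℝ) (ω : Sample m n) (u : Layer m n) :
    tailField x y r t k (ω.1, Function.update ω.2 (k + 1) u)
      = tailField x y r t (k + 1) ω + layerNoise x y t (layerEquiv u) := by
  have later_layers : ∀ j ∈ Finset.Ioc (k + 1) (r + 1),
      layerNoise x y t (layerEquiv (Function.update ω.2 (k + 1) u j))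
        = layerNoise x y t (layerEquiv (ω.2 j)) := fun j hj => by
    rw [Function.update_of_ne (Finset.mem_Ioc.1 hj).1.ne']
  simp only [tailField]
  rw [← Finset.add_sum_Ioc_eq_sum_Icc (by omega : k + 1 ≤ r + 1),
    Function.update_self, Finset.sum_congr rfl later_layers, Finset.Icc_add_one_left_eq_Ioc]
  abel

lemma tailField_succ_update (r k : ℕ) (t : ℝ) (ω : Sample m n) (u : Layer m n) :
    tailField x y r t (k + 1) (ω.1, Function.update ω.2 (k + 1) u)
      = tailField x y r t (k + 1) ω := by
  simp only [tailField]
  congr 1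
  refine Finset.sum_congr rfl fun j hj => ?_
  rw [Function.update_of_ne (by grind)]

lemma tailField_outer (r : ℕ) (t : ℝ) (z : (Fin m → Fin n → ℝ) × Layer m n) :
    tailField x y r t r (z.1, Function.update 0 (r + 1) z.2)
      = outerNoise x y t (outerEquiv z) := by
  ext i
  simp only [tailField, outerNoise, layerNoise, noiseMap_apply, outerEquiv_apply, outerPhase,
    outerWeight, Fintype.sum_sum_type, Fintype.sum_prod_type, Sum.elim_inl, Sum.elim_inr,
    Finset.Icc_self, Finset.sum_singleton, Function.update_self, Pi.add_apply, Finset.sum_apply,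
    Pi.smul_apply, smul_eq_mul, Finset.mul_sum]
  congr 1
  exact Finset.sum_congr rfl fun a _ => Finset.sum_congr rfl fun b _ => by ring

variable (p q : ℕ → ℝ)

lemma layerExp_tailField {r k : ℕ} (hk : k ≤ r) (f : ℝ → (Fin l × Fin l → ℝ) → ℝ) (t : ℝ)
    (ω : Sample m n) :
    layerExp p q (k + 1) (fun ω => f t (tailField x y r t k ω)) ω
      = avg (gaussPi (layerVar m n p q (k + 1))) (layerNoise x y) f t
          (tailField x y r t (k + 1) ω) := by
  simp only [layerExp, tailField_update x y hk]
  exact (measurePreserving_layerEquiv p q (k + 1)).integral_comp'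
    fun z => f t (tailField x y r t (k + 1) ω + layerNoise x y t z)

lemma outerExp_tailField (r : ℕ) (f : ℝ → (Fin l × Fin l → ℝ) → ℝ) (t : ℝ) :
    outerExp p q r (fun ω : Sample m n => f t (tailField x y r t r ω))
      = avg (gaussPi (outerVar m n p q (r + 1))) (outerNoise x y) f t 0 := by
  simp only [outerExp, tailField_outer, avg, zero_add]
  exact (measurePreserving_outerEquiv p q (r + 1)).integral_comp' fun z => f t (outerNoise x y t z)

end Field

section Bridge

variable {l : ℕ}

/-- `C` as a function of the values `v` of the process `D₀`. -/
def gibbsC (β : ℝ) (i₁ : Fin l) (v : Fin l × Fin l → ℝ) : ℝ :=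
  ∑ i₂, Real.exp (β * v (i₁, i₂))

/-- `Z` as a function of the values `v` of the process `D₀`. -/
def gibbsZ (β s : ℝ) (v : Fin l × Fin l → ℝ) : ℝ :=
  ∑ i₁, gibbsC β i₁ v ^ s

/-- `γ₀` as a function of the values `v` of the process `D₀`. -/
def gibbsWeight (β s : ℝ) (i : Fin l × Fin l) (v : Fin l × Fin l → ℝ) : ℝ :=
  gibbsC β i.1 v ^ s / gibbsZ β s v * (Real.exp (β * v i) / gibbsC β i.1 v)

/-- The weight that is averaged in `γ₀₂`, as a function of the values `v` of the process `D₀`. -/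
def gibbsPairWeight (β s : ℝ) (i₁ i₂ p₂ : Fin l) (v : Fin l × Fin l → ℝ) : ℝ :=
  gibbsC β i₁ v ^ s / gibbsZ β s v * (Real.exp (β * v (i₁, i₂)) / gibbsC β i₁ v)
    * (Real.exp (β * v (i₁, p₂)) / gibbsC β i₁ v)

variable {m n : ℕ} (x : Fin l → EuclideanSpace ℝ (Fin n)) (y : Fin l → EuclideanSpace ℝ (Fin m))
  (p q c : ℕ → ℝ) (β s : ℝ)

/-- The tower whose value at `tailField` is `ζ`. -/
abbrev gibbsTower : ℕ → ℝ → (Fin l × Fin l → ℝ) → ℝ :=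
  tower (fun k => gaussPi (layerVar m n p q k)) (layerNoise x y) c fun _ => gibbsZ β s

/-- The reweighted averages whose value at `tailField` is that of `Φchain`. -/
abbrev gibbsChain {E : Type*} [NormedAddCommGroup E] [NormedSpace ℝ E] (b k : ℕ)
    (f : ℝ → (Fin l × Fin l → ℝ) → E) : ℝ → (Fin l × Fin l → ℝ) → E :=
  tiltChain (fun k => gaussPi (layerVar m n p q k)) (layerNoise x y) c (fun _ => gibbsZ β s) b k f

lemma C_eq (r : ℕ) (t : ℝ) (i₁ : Fin l) (ω : Sample m n) :
    C r x y β t i₁ ω = gibbsC β i₁ (tailField x y r t 0 ω) := by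
  simp only [C, A, gibbsC, D₀_eq_tailField]

lemma Z_eq (r : ℕ) (t : ℝ) (ω : Sample m n) :
    Z r x y β s t ω = gibbsZ β s (tailField x y r t 0 ω) := by
  simp only [Z, gibbsZ, C_eq]

lemma ζ_eq {r k : ℕ} (hk : k ≤ r) (t : ℝ) (ω : Sample m n) :
    ζ r x y p q c β s t k ω = gibbsTower x y p q c β s k t (tailField x y r t k ω) := by
  induction k generalizing ω with
  | zero => exact Z_eq x y β s r t ω
  | succ k ih =>
    simp only [ζ, ih (by omega)]
    exact layerExp_tailField x y p q (by omega)
      (fun t v => gibbsTower x y p q c β s k t v ^ (c (k + 1) / c k)) t ω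

lemma Φ_eq {r k : ℕ} (hk : k < r) (t : ℝ) (f : ℝ → (Fin l × Fin l → ℝ) → ℝ) :
    Φ r x y p q c β s t (k + 1) (fun ω => f t (tailField x y r t k ω))
      = fun ω => tiltStep (fun k => gaussPi (layerVar m n p q k)) (layerNoise x y) c
          (fun _ => gibbsZ β s) k f t (tailField x y r t (k + 1) ω) := by
  funext ω
  have reweighted_avg := layerExp_tailField x y p q hk.le
    (fun t v => gibbsTower x y p q c β s k t v ^ (c (k + 1) / c k) • f t v) t ω
  rw [tiltStep, tilt, ← reweighted_avg, Φ, layerExp, layerExp, smul_eq_mul, ← integral_const_mul]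
  simp only [Nat.add_sub_cancel, ζ_eq x y p q c β s (Nat.succ_le_of_lt hk),
    ζ_eq x y p q c β s hk.le, tailField_succ_update]
  refine integral_congr_ae (ae_of_all _ fun u => ?_)
  beta_reduce
  rw [div_mul_eq_mul_div, div_eq_inv_mul]
  rfl

lemma Φchain_eq {r b k : ℕ} (hb : 1 ≤ b) (hbk : b ≤ k + 1) (hk : k ≤ r) (t : ℝ)
    (f : ℝ → (Fin l × Fin l → ℝ) → ℝ) :
    Φchain r x y p q c β s t b k (fun ω => f t (tailField x y r t (b - 1) ω))
      = fun ω => gibbsChain x y p q c β s b k f t (tailField x y r t k ω) := by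
  induction k with
  | zero =>
    obtain rfl : b = 1 := by omega
    rfl
  | succ k ih =>
    rw [Φchain]
    split_ifs with h
    · rw [ih h (by omega), Φ_eq x y p q c β s hk]
      simp only [gibbsChain, tiltChain_succ h]
    · obtain rfl : b = k + 2 := by omega
      rw [gibbsChain, tiltChain_of_lt (by omega)]
      rfl

lemma γ₀_eq (r : ℕ) (t : ℝ) (i₁ i₂ : Fin l) :
    γ₀ r x y β s t i₁ i₂ = fun ω : Sample m n =>
      gibbsWeight β s (i₁, i₂) (tailField x y r t 0 ω) := by
  funext ω
  simp only [γ₀, gibbsWeight, A, D₀_eq_tailField, Z_eq, C_eq]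

lemma γ₀₁_eq (r : ℕ) (t : ℝ) (i₁ i₂ : Fin l) :
    γ₀₁ r x y p q c β s t i₁ i₂ = fun ω : Sample m n =>
      gibbsChain x y p q c β s 1 r (fun _ => gibbsWeight β s (i₁, i₂)) t
        (tailField x y r t r ω) := by
  rw [γ₀₁, γ₀_eq]
  exact Φchain_eq x y p q c β s le_rfl (by omega) le_rfl t fun _ => gibbsWeight β s (i₁, i₂)

lemma γ₀₂_eq (r : ℕ) (t : ℝ) (i₁ i₂ p₂ : Fin l) :
    γ₀₂ r x y p q c β s t i₁ i₂ p₂ = fun ω : Sample m n =>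
      gibbsChain x y p q c β s 1 r (fun _ => gibbsPairWeight β s i₁ i₂ p₂) t
        (tailField x y r t r ω) := by
  simp only [γ₀₂, A, D₀_eq_tailField, Z_eq, C_eq]
  exact Φchain_eq x y p q c β s le_rfl (by omega) le_rfl t fun _ => gibbsPairWeight β s i₁ i₂ p₂

lemma γ_eq {r k : ℕ} (hk : 1 ≤ k) (hkr : k ≤ r + 1) (t : ℝ) (i₁ i₂ p₁ p₂ : Fin l) :
    γ r x y p q c β s t k i₁ i₂ p₁ p₂ = fun ω : Sample m n =>
      gibbsChain x y p q c β s k r (fun t v =>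
        gibbsChain x y p q c β s 1 (k - 1) (fun _ => gibbsWeight β s (i₁, i₂)) t v
          * gibbsChain x y p q c β s 1 (k - 1) (fun _ => gibbsWeight β s (p₁, p₂)) t v) t
        (tailField x y r t r ω) := by
  have inner_chain (i : Fin l × Fin l) :
      Φchain r x y p q c β s t 1 (k - 1) (γ₀ r x y β s t i.1 i.2)
        = fun ω => gibbsChain x y p q c β s 1 (k - 1) (fun _ => gibbsWeight β s i) t
            (tailField x y r t (k - 1) ω) := by
    rw [γ₀_eq]
    exact Φchain_eq x y p q c β s le_rfl (by omega) (by omega) t fun _ => gibbsWeight β s i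
  rw [γ, inner_chain (i₁, i₂), inner_chain (p₁, p₂)]
  exact Φchain_eq x y p q c β s hk hkr le_rfl t fun t v =>
    gibbsChain x y p q c β s 1 (k - 1) (fun _ => gibbsWeight β s (i₁, i₂)) t v
      * gibbsChain x y p q c β s 1 (k - 1) (fun _ => gibbsWeight β s (p₁, p₂)) t v

end Bridge

section Gibbs

variable {T : Type*} {l : ℕ} (β s : ℝ)

lemma posExpGrowth_exp_proj (S : Set T) (i : Fin l × Fin l) :
    PosExpGrowth S fun _ (v : Fin l × Fin l → ℝ) => Real.exp (β * v i) :=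
  .exp_clm S (β • (ContinuousLinearMap.proj i : (Fin l × Fin l → ℝ) →L[ℝ] ℝ))

lemma posExpGrowth_gibbsC [NeZero l] (S : Set T) (i₁ : Fin l) :
    PosExpGrowth S fun _ => gibbsC β i₁ :=
  .sum Finset.univ_nonempty fun i₂ _ => posExpGrowth_exp_proj β S (i₁, i₂)

lemma posExpGrowth_gibbsZ [NeZero l] (S : Set T) : PosExpGrowth S fun _ => gibbsZ (l := l) β s :=
  .sum Finset.univ_nonempty fun i₁ _ => (posExpGrowth_gibbsC β S i₁).rpow s

lemma posExpGrowth_gibbsWeight [NeZero l] (S : Set T) (i : Fin l × Fin l) :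
    PosExpGrowth S fun _ => gibbsWeight β s i :=
  (((posExpGrowth_gibbsC β S i.1).rpow s).div (posExpGrowth_gibbsZ β s S)).mul
    ((posExpGrowth_exp_proj β S i).div (posExpGrowth_gibbsC β S i.1))

lemma posExpGrowth_gibbsPairWeight [NeZero l] (S : Set T) (i₁ i₂ p₂ : Fin l) :
    PosExpGrowth S fun _ => gibbsPairWeight β s i₁ i₂ p₂ :=
  (posExpGrowth_gibbsWeight β s S (i₁, i₂)).mul
    ((posExpGrowth_exp_proj β S (i₁, p₂)).div (posExpGrowth_gibbsC β S i₁))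

lemma gibbsC_pos [NeZero l] (i₁ : Fin l) (v : Fin l × Fin l → ℝ) : 0 < gibbsC β i₁ v :=
  Finset.sum_pos (fun _ _ => Real.exp_pos _) Finset.univ_nonempty

lemma gibbsZ_pos [NeZero l] (v : Fin l × Fin l → ℝ) : 0 < gibbsZ β s v :=
  Finset.sum_pos (fun i₁ _ => Real.rpow_pos_of_pos (gibbsC_pos β i₁ v) s) Finset.univ_nonempty

lemma hasFDerivAt_exp_proj (i : Fin l × Fin l) (v : Fin l × Fin l → ℝ) :
    HasFDerivAt (fun v : Fin l × Fin l → ℝ => Real.exp (β * v i))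
      ((Real.exp (β * v i) * β) • (ContinuousLinearMap.proj i : (Fin l × Fin l → ℝ) →L[ℝ] ℝ))
      v := by
  simpa only [smul_smul] using ((hasFDerivAt_apply i v).const_mul β).exp

lemma hasFDerivAt_gibbsC (i₁ : Fin l) (v : Fin l × Fin l → ℝ) :
    HasFDerivAt (gibbsC β i₁) (∑ i₂, (Real.exp (β * v (i₁, i₂)) * β) •
      (ContinuousLinearMap.proj (i₁, i₂) : (Fin l × Fin l → ℝ) →L[ℝ] ℝ)) v :=
  .fun_sum fun i₂ _ => hasFDerivAt_exp_proj β (i₁, i₂) v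

lemma gibbsZ_mul_gibbsWeight [NeZero l] (i : Fin l × Fin l) (v : Fin l × Fin l → ℝ) :
    gibbsZ β s v * gibbsWeight β s i v = gibbsC β i.1 v ^ (s - 1) * Real.exp (β * v i) := by
  have hZ := (gibbsZ_pos β s v).ne'
  have hC := (gibbsC_pos β i.1 v).ne'
  rw [gibbsWeight, Real.rpow_sub_one hC]
  field_simp

lemma gibbsZ_mul_gibbsPairWeight [NeZero l] (i₁ i₂ p₂ : Fin l) (v : Fin l × Fin l → ℝ) :
    gibbsZ β s v * gibbsPairWeight β s i₁ i₂ p₂ v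
      = gibbsC β i₁ v ^ (s - 2) * Real.exp (β * v (i₁, i₂)) * Real.exp (β * v (i₁, p₂)) := by
  have hZ := (gibbsZ_pos β s v).ne'
  have hC := gibbsC_pos β i₁ v
  rw [gibbsPairWeight, Real.rpow_sub hC, Real.rpow_two]
  field_simp

lemma hasFDerivAt_gibbsZ [NeZero l] (v : Fin l × Fin l → ℝ) :
    HasFDerivAt (gibbsZ β s) (∑ i, (gibbsZ β s v * gibbsWeight β s i v * (s * β)) •
      (ContinuousLinearMap.proj i : (Fin l × Fin l → ℝ) →L[ℝ] ℝ)) v := by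
  refine (HasFDerivAt.fun_sum fun i₁ _ => (hasFDerivAt_gibbsC β i₁ v).rpow_const (p := s)
    (.inl (gibbsC_pos β i₁ v).ne')).congr_fderiv ?_
  simp only [gibbsZ_mul_gibbsWeight, Fintype.sum_prod_type, Finset.smul_sum, smul_smul]
  exact Finset.sum_congr rfl fun i₁ _ => Finset.sum_congr rfl fun i₂ _ =>
    congrArg (· • _) (by ring)

lemma hasFDerivAt_gibbsZ_mul_gibbsWeight [NeZero l] (i : Fin l × Fin l)
    (v : Fin l × Fin l → ℝ) :
    HasFDerivAt (fun v => gibbsZ β s v * gibbsWeight β s i v)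
      ((gibbsZ β s v * gibbsWeight β s i v * β) •
          (ContinuousLinearMap.proj i : (Fin l × Fin l → ℝ) →L[ℝ] ℝ)
        + ∑ p₂, (gibbsZ β s v * gibbsPairWeight β s i.1 i.2 p₂ v * ((s - 1) * β)) •
          (ContinuousLinearMap.proj (i.1, p₂) : (Fin l × Fin l → ℝ) →L[ℝ] ℝ)) v := by
  simp only [gibbsZ_mul_gibbsWeight, gibbsZ_mul_gibbsPairWeight]
  refine (((hasFDerivAt_gibbsC β i.1 v).rpow_const (p := s - 1)
    (.inl (gibbsC_pos β i.1 v).ne')).mul (hasFDerivAt_exp_proj β i v)).congr_fderiv ?_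
  simp only [smul_smul, Finset.smul_sum, mul_assoc]
  congr 1
  refine Finset.sum_congr rfl fun p₂ _ => congrArg (· • _) ?_
  rw [sub_sub, one_add_one_eq_two]
  ring

/-- The logarithmic gradient of `gibbsZ`. -/
def gibbsGrad (_ : T) (v : Fin l × Fin l → ℝ) : (Fin l × Fin l → ℝ) →L[ℝ] ℝ :=
  ∑ i, gibbsWeight β s i v • (s * β) • ContinuousLinearMap.proj i

/-- The Hessian of `gibbsZ` divided by `gibbsZ`. -/
def gibbsHess (_ : T) (v : Fin l × Fin l → ℝ) :
    (Fin l × Fin l → ℝ) →L[ℝ] (Fin l × Fin l → ℝ) →L[ℝ] ℝ :=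
  ∑ i, gibbsWeight β s i v • (s * β ^ 2) •
      (ContinuousLinearMap.proj i).smulRight (ContinuousLinearMap.proj i)
    + ∑ i : Fin l × Fin l, ∑ p₂, gibbsPairWeight β s i.1 i.2 p₂ v • (s * (s - 1) * β ^ 2) •
      (ContinuousLinearMap.proj (i.1, p₂)).smulRight (ContinuousLinearMap.proj i)

lemma hasFDerivAt_gibbsZ_smul_gibbsGrad [NeZero l] (t : T) (v : Fin l × Fin l → ℝ) :
    HasFDerivAt (fun v => gibbsZ β s v • gibbsGrad β s t v)
      (gibbsZ β s v • gibbsHess β s t v) v := by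
  have gibbsZ_smul (v : Fin l × Fin l → ℝ) : gibbsZ β s v • gibbsGrad β s t v
      = ∑ i, (gibbsZ β s v * gibbsWeight β s i v) • (s * β) • ContinuousLinearMap.proj i := by
    simp only [gibbsGrad, Finset.smul_sum, smul_smul, mul_assoc]
  simp only [gibbsZ_smul]
  refine (HasFDerivAt.fun_sum fun i _ =>
    (hasFDerivAt_gibbsZ_mul_gibbsWeight β s i v).smul_const _).congr_fderiv ?_
  rw [gibbsHess, smul_add, Finset.smul_sum, Finset.smul_sum, ← Finset.sum_add_distrib]
  refine Finset.sum_congr rfl fun i _ => ContinuousLinearMap.ext fun w =>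
    ContinuousLinearMap.ext fun u => ?_
  simp only [ContinuousLinearMap.smulRight_apply, ContinuousLinearMap.proj_apply, add_apply,
    sum_apply, smul_apply, smul_eq_mul, Finset.mul_sum, Finset.sum_mul, add_mul]
  exact congrArg₂ _ (by ring) (Finset.sum_congr rfl fun p₂ _ => by ring)

lemma isLogJet_gibbsZ [NeZero l] (S : Set ℝ) :
    IsLogJet S 1 (fun _ => gibbsZ (l := l) β s) (fun _ _ => 0) (gibbsGrad β s)
      (gibbsHess β s) where
  posGrowth := posExpGrowth_gibbsZ β s S
  growth_time := .const S 0
  growth_grad := .sum fun i _ => (posExpGrowth_gibbsWeight β s S i).growth.smul (.const S _)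
  growth_hess :=
    .add (.sum fun i _ => (posExpGrowth_gibbsWeight β s S i).growth.smul (.const S _)) <|
      .sum fun i _ => .sum fun p₂ _ =>
        (posExpGrowth_gibbsPairWeight β s S i.1 i.2 p₂).growth.smul (.const S _)
  hasFDerivAt t _ v := by
    refine (HasFDerivAt.comp (g := gibbsZ β s) (t, v) (hasFDerivAt_gibbsZ β s v)
      hasFDerivAt_snd).congr_fderiv (ContinuousLinearMap.ext fun w => ?_)
    simp only [ContinuousLinearMap.comp_apply, ContinuousLinearMap.coe_snd', sum_apply, smul_apply,
      ContinuousLinearMap.proj_apply, smul_eq_mul, timeSpaceDeriv_apply, gibbsGrad, one_mul,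
      mul_zero, zero_add, Finset.mul_sum, mul_assoc]
  hasFDerivAt_grad t _ v := by
    simpa only [one_mul] using hasFDerivAt_gibbsZ_smul_gibbsGrad β s t v

end Gibbs

section Covariance

variable {m n l : ℕ} (x : Fin l → EuclideanSpace ℝ (Fin n)) (y : Fin l → EuclideanSpace ℝ (Fin m))

/-- The time derivative of `layerPhase`. -/
def layerPhaseDeriv : LayerIndex m n → ℝ → ℝ :=
  Sum.elim (fun _ t => 1 / (2 * √t)) (fun _ t => -(1 / (2 * √(1 - t))))

/-- The time derivative of `outerPhase`. -/
def outerPhaseDeriv : OuterIndex m n → ℝ → ℝ :=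
  Sum.elim (fun _ t => 1 / (2 * √t)) layerPhaseDeriv

lemma hasDerivAt_sqrt_one_sub {t : ℝ} (ht : t < 1) :
    HasDerivAt (fun t => √(1 - t)) (-(1 / (2 * √(1 - t)))) t :=
  (((hasDerivAt_id' t).const_sub 1).sqrt (sub_pos.2 ht).ne').congr_deriv (neg_div _ _)

lemma abs_sqrt_le_one {u : ℝ} (hu : u ≤ 1) : |√u| ≤ 1 := by
  rw [abs_of_nonneg (Real.sqrt_nonneg u)]
  exact Real.sqrt_le_one.2 hu

lemma abs_one_div_two_mul_sqrt_le {δ u : ℝ} (hδ : 0 < δ) (hu : δ ≤ u) :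
    |1 / (2 * √u)| ≤ 1 / (2 * √δ) := by
  have := Real.sqrt_pos.2 hδ
  rw [abs_of_nonneg (by positivity)]
  gcongr

variable {δ : ℝ}

lemma layerPhase_bounds (hδ : 0 < δ) (j : LayerIndex m n) {t : ℝ} (ht : t ∈ Set.Ioo δ (1 - δ)) :
    HasDerivAt (layerPhase j) (layerPhaseDeriv j t) t ∧
      |layerPhase j t| ≤ 1 + 1 / (2 * √δ) ∧ |layerPhaseDeriv j t| ≤ 1 + 1 / (2 * √δ) := by
  obtain ⟨hδt, htδ⟩ := ht
  have h_inv_sqrt : 0 ≤ 1 / (2 * √δ) := by positivity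
  rcases j with j | j
  · exact ⟨Real.hasDerivAt_sqrt (hδ.trans hδt).ne',
      (abs_sqrt_le_one (by linarith)).trans (by linarith),
      (abs_one_div_two_mul_sqrt_le hδ hδt.le).trans (by linarith)⟩
  · refine ⟨hasDerivAt_sqrt_one_sub (by linarith),
      (abs_sqrt_le_one (by linarith)).trans (by linarith), ?_⟩
    rw [layerPhaseDeriv, Sum.elim_inr, abs_neg]
    exact (abs_one_div_two_mul_sqrt_le hδ (by linarith)).trans (by linarith)

lemma smoothPath_layerNoise (hδ : 0 < δ) :
    SmoothPath (Set.Ioo δ (1 - δ)) (layerNoise x y)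
      (noiseMap layerPhaseDeriv (layerWeight x y)) :=
  smoothPath_noiseMap isOpen_Ioo (fun j _ ht => (layerPhase_bounds hδ j ht).1)
    (by positivity : 0 ≤ 1 + 1 / (2 * √δ)) (fun j _ ht => (layerPhase_bounds hδ j ht).2) _

lemma smoothPath_outerNoise (hδ : 0 < δ) :
    SmoothPath (Set.Ioo δ (1 - δ)) (outerNoise x y)
      (noiseMap outerPhaseDeriv (outerWeight x y)) := by
  have outerPhase_bounds (j : OuterIndex m n) : ∀ t ∈ Set.Ioo δ (1 - δ),
      HasDerivAt (outerPhase j) (outerPhaseDeriv j t) t ∧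
        |outerPhase j t| ≤ 1 + 1 / (2 * √δ) ∧ |outerPhaseDeriv j t| ≤ 1 + 1 / (2 * √δ) := by
    rcases j with _ | j
    · exact fun t ht => layerPhase_bounds (m := m) (n := n) hδ (Sum.inl ()) ht
    · exact fun t ht => layerPhase_bounds hδ j ht
  exact smoothPath_noiseMap isOpen_Ioo (fun j t ht => (outerPhase_bounds j t ht).1)
    (by positivity : 0 ≤ 1 + 1 / (2 * √δ)) (fun j t ht => (outerPhase_bounds j t ht).2) _

/-- Half the kernel that is averaged in `φ (k + 1)`. -/
def overlapKernel (p q : ℕ → ℝ) (k : ℕ) (i j : Fin l × Fin l) : ℝ :=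
  1 / 2 * ((p k * (‖x i.1‖ * ‖x j.1‖) - inner ℝ (x j.1) (x i.1))
    * (q k * (‖y i.2‖ * ‖y j.2‖) - inner ℝ (y j.2) (y i.2)))

lemma inner_eq_sum {d : ℕ} (u w : EuclideanSpace ℝ (Fin d)) : inner ℝ w u = ∑ a, u a * w a := by
  simp [PiLp.inner_apply]

lemma layerPhase_mul_layerPhaseDeriv {t : ℝ} (ht : t ∈ Set.Ioo (0 : ℝ) 1) (j : LayerIndex m n) :
    layerPhase j t * layerPhaseDeriv j t = Sum.elim (fun _ => 1 / 2) (fun _ => -(1 / 2)) j := by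
  have := (Real.sqrt_pos.2 ht.1).ne'
  have := (Real.sqrt_pos.2 (sub_pos.2 ht.2)).ne'
  rcases j with j | j <;> simp only [layerPhaseDeriv, layerPhase, Sum.elim_inl, Sum.elim_inr] <;>
    field_simp

variable {p q : ℕ → ℝ}

lemma sum_layerVar_mul {k : ℕ} (hp : p (k + 1) ≤ p k) (hq : q (k + 1) ≤ q k)
    (hp0 : 0 ≤ p (k + 1)) (hq0 : 0 ≤ q (k + 1)) {t : ℝ} (ht : t ∈ Set.Ioo (0 : ℝ) 1)
    (i j : Fin l × Fin l) :
    ∑ a, layerVar m n p q (k + 1) a * (layerPhase a t * layerPhaseDeriv a t)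
        * (layerWeight x y a i * layerWeight x y a j)
      = overlapKernel x y p q k i j - overlapKernel x y p q (k + 1) i j := by
  have hpq : 0 ≤ p k * q k - p (k + 1) * q (k + 1) :=
    sub_nonneg.2 (mul_le_mul hp hq hq0 (hp0.trans hp))
  simp only [layerPhase_mul_layerPhaseDeriv ht, Fintype.sum_sum_type, layerVar, layerWeight,
    Sum.elim_inl, Sum.elim_inr, Nat.add_sub_cancel, Real.coe_toNNReal _ hpq,
    Real.coe_toNNReal _ (sub_nonneg.2 hp), Real.coe_toNNReal _ (sub_nonneg.2 hq),
    Finset.univ_unique, Finset.sum_singleton]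
  have sum_y : ∑ a, ‖x i.1‖ * y i.2 a * (‖x j.1‖ * y j.2 a)
      = ‖x i.1‖ * ‖x j.1‖ * inner ℝ (y j.2) (y i.2) := by
    rw [inner_eq_sum, Finset.mul_sum]
    exact Finset.sum_congr rfl fun a _ => by ring
  have sum_x : ∑ b, ‖y i.2‖ * x i.1 b * (‖y j.2‖ * x j.1 b)
      = ‖y i.2‖ * ‖y j.2‖ * inner ℝ (x j.1) (x i.1) := by
    rw [inner_eq_sum, Finset.mul_sum]
    exact Finset.sum_congr rfl fun b _ => by ring
  rw [← Finset.mul_sum, ← Finset.mul_sum, sum_y, sum_x, overlapKernel, overlapKernel]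
  ring

lemma sum_mul_sqrt_entries {t : ℝ} (ht : 0 < t) (i j : Fin l × Fin l) :
    ∑ a : Fin m × Fin n, √t * (1 / (2 * √t)) * (y i.2 a.1 * x i.1 a.2 * (y j.2 a.1 * x j.1 a.2))
      = 1 / 2 * (inner ℝ (x j.1) (x i.1) * inner ℝ (y j.2) (y i.2)) := by
  have h_half : √t * (1 / (2 * √t)) = 1 / 2 := by
    have := (Real.sqrt_pos.2 ht).ne'
    field_simp
  rw [← Finset.mul_sum, h_half, Fintype.sum_prod_type, inner_eq_sum, inner_eq_sum,
    mul_comm (∑ b, _), Finset.sum_mul_sum]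
  exact congrArg _ (Finset.sum_congr rfl fun a _ => Finset.sum_congr rfl fun b _ => by ring)

lemma covForm_layerNoise {k : ℕ} (hp : p (k + 1) ≤ p k) (hq : q (k + 1) ≤ q k)
    (hp0 : 0 ≤ p (k + 1)) (hq0 : 0 ≤ q (k + 1)) {t : ℝ} (ht : t ∈ Set.Ioo (0 : ℝ) 1) :
    covForm (layerVar m n p q (k + 1)) (layerNoise x y t)
        (noiseMap layerPhaseDeriv (layerWeight x y) t)
      = kernelForm (overlapKernel x y p q k) - kernelForm (overlapKernel x y p q (k + 1)) := by
  rw [layerNoise, covForm_noiseMap, ← kernelForm_sub]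
  simp only [sum_layerVar_mul x y hp hq hp0 hq0 ht]

lemma covForm_outerNoise {r : ℕ} (hp : p (r + 1) ≤ p r) (hq : q (r + 1) ≤ q r)
    (hpr : p (r + 1) = 0) (hqr : q (r + 1) = 0) {t : ℝ} (ht : t ∈ Set.Ioo (0 : ℝ) 1) :
    covForm (outerVar m n p q (r + 1)) (outerNoise x y t)
        (noiseMap outerPhaseDeriv (outerWeight x y) t)
      = kernelForm (overlapKernel x y p q r) := by
  rw [outerNoise, covForm_noiseMap]
  congr 1
  funext i j
  have layer_part := sum_layerVar_mul x y hp hq hpr.ge hqr.ge ht i j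
  simp only [Fintype.sum_sum_type, outerVar, outerPhase, outerPhaseDeriv, outerWeight,
    Sum.elim_inl, Sum.elim_inr, NNReal.coe_one, one_mul] at layer_part ⊢
  rw [layer_part, sum_mul_sqrt_entries x y ht.1, overlapKernel, overlapKernel, hpr, hqr]
  ring

end Covariance

section Replicas

variable {m n l : ℕ} (x : Fin l → EuclideanSpace ℝ (Fin n)) (y : Fin l → EuclideanSpace ℝ (Fin m))
  (p q c : ℕ → ℝ) (β s : ℝ)

/-- The sum over pairs of configurations that is averaged in `φ k`, as a function of the values
`v` of the process `D₀`. -/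
def pairSum (r k : ℕ) (t : ℝ) (v : Fin l × Fin l → ℝ) : ℝ :=
  ∑ w : (Fin l × Fin l) × (Fin l × Fin l), 2 * overlapKernel x y p q (k - 1) w.1 w.2
    * gibbsChain x y p q c β s k r (fun t v =>
        gibbsChain x y p q c β s 1 (k - 1) (fun _ => gibbsWeight β s w.1) t v
          * gibbsChain x y p q c β s 1 (k - 1) (fun _ => gibbsWeight β s w.2) t v) t v

/-- The sum that is averaged in `φ₀₁`, as a function of the values `v` of the process `D₀`. -/
def diagSum (r : ℕ) (t : ℝ) (v : Fin l × Fin l → ℝ) : ℝ :=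
  ∑ i : Fin l × Fin l, ‖x i.1‖ ^ 2 * ‖y i.2‖ ^ 2
    * gibbsChain x y p q c β s 1 r (fun _ => gibbsWeight β s i) t v

/-- The sum that is averaged in `φ₀₂`, as a function of the values `v` of the process `D₀`. -/
def semidiagSum (r : ℕ) (t : ℝ) (v : Fin l × Fin l → ℝ) : ℝ :=
  ∑ w : (Fin l × Fin l) × Fin l,
    ‖x w.1.1‖ ^ 2 * (q 0 * (‖y w.1.2‖ * ‖y w.2‖) - inner ℝ (y w.2) (y w.1.2))
      * gibbsChain x y p q c β s 1 r (fun _ => gibbsPairWeight β s w.1.1 w.1.2 w.2) t v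

/-- The combination of `pairSum`, `diagSum` and `semidiagSum` whose average is
`φ 1 + ⋯ + φ (r + 1) + φ₀₁ + φ₀₂`. -/
def replicaSum (r : ℕ) (t : ℝ) (v : Fin l × Fin l → ℝ) : ℝ :=
  (∑ k ∈ Finset.Icc 1 (r + 1), -s * (c (k - 1) - c k) * pairSum x y p q c β s r k t v)
    + (1 - p 0) * (1 - q 0) * diagSum x y p q c β s r t v
    + -(s - 1) * (1 - p 0) * semidiagSum x y p q c β s r t v

/-- The contribution to the derivative of two replicas that share the layers above `k`. -/
abbrev gibbsOverlap (k : ℕ) : ℝ → (Fin l × Fin l → ℝ) → ℝ :=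
  overlap (fun k => gaussPi (layerVar m n p q k)) (layerNoise x y) c (fun _ => gibbsZ β s)
    (fun k => kernelForm (overlapKernel x y p q k)) (gibbsGrad β s) k

lemma φ_eq {r k : ℕ} (hk : 1 ≤ k) (hkr : k ≤ r + 1) (t : ℝ) :
    φ r x y p q c β s t k = -s * (c (k - 1) - c k)
      * avg (gaussPi (outerVar m n p q (r + 1))) (outerNoise x y) (pairSum x y p q c β s r k)
          t 0 := by
  rw [φ, ← outerExp_tailField]
  congr 2
  funext ω
  simp only [pairSum, Fintype.sum_prod_type, γ_eq x y p q c β s hk hkr, overlapKernel,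
    mul_one_div_cancel (two_ne_zero' ℝ), ← mul_assoc, one_mul]

lemma φ₀₁_eq (r : ℕ) (t : ℝ) :
    φ₀₁ r x y p q c β s t = (1 - p 0) * (1 - q 0)
      * avg (gaussPi (outerVar m n p q (r + 1))) (outerNoise x y) (diagSum x y p q c β s r)
          t 0 := by
  rw [φ₀₁, ← outerExp_tailField]
  congr 2
  funext ω
  simp only [diagSum, Fintype.sum_prod_type, γ₀₁_eq x y p q c β s]

lemma φ₀₂_eq (r : ℕ) (t : ℝ) :
    φ₀₂ r x y p q c β s t = -(s - 1) * (1 - p 0)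
      * avg (gaussPi (outerVar m n p q (r + 1))) (outerNoise x y) (semidiagSum x y p q c β s r)
          t 0 := by
  rw [φ₀₂, ← outerExp_tailField]
  congr 2
  funext ω
  simp only [semidiagSum, Fintype.sum_prod_type, γ₀₂_eq x y p q c β s]

lemma kernelForm_gibbsHess (t : ℝ) (v : Fin l × Fin l → ℝ) :
    kernelForm (overlapKernel x y p q 0) (gibbsHess β s t v)
      = ∑ i, gibbsWeight β s i v * (s * β ^ 2 / 2
            * ((1 - p 0) * (1 - q 0) * (‖x i.1‖ ^ 2 * ‖y i.2‖ ^ 2)))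
        + ∑ w : (Fin l × Fin l) × Fin l, gibbsPairWeight β s w.1.1 w.1.2 w.2 v * (s * β ^ 2 / 2
            * (-(s - 1) * (1 - p 0) * (‖x w.1.1‖ ^ 2
              * (q 0 * (‖y w.1.2‖ * ‖y w.2‖) - inner ℝ (y w.2) (y w.1.2))))) := by
  rw [Fintype.sum_prod_type (f := fun w : (Fin l × Fin l) × Fin l => _)]
  simp only [gibbsHess, map_add, map_sum, map_smul, kernelForm_smulRight_proj, smul_eq_mul,
    overlapKernel, real_inner_self_eq_norm_sq]
  congr 1
  · exact Finset.sum_congr rfl fun i _ => by ring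
  · refine Finset.sum_congr rfl fun i _ => Finset.sum_congr rfl fun p₂ _ => ?_
    rw [real_inner_comm]
    ring

variable {S : Set ℝ} {L' : ℝ → (LayerIndex m n → ℝ) →L[ℝ] (Fin l × Fin l → ℝ)} [NeZero l]
  (hL : SmoothPath S (layerNoise x y) L')

include hL

lemma growth_gibbsChain {E : Type*} [NormedAddCommGroup E] [NormedSpace ℝ E] (b k : ℕ)
    {f : ℝ → (Fin l × Fin l → ℝ) → E} (hf : ExpGrowth S f) :
    ExpGrowth S (gibbsChain x y p q c β s b k f) :=
  hL.growth_tiltChain (fun _ => finiteExpMoments_gaussPi _) (posExpGrowth_gibbsZ β s S) b k hf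

lemma gibbsChain_sum_smul {E ι : Type*} [NormedAddCommGroup E] [NormedSpace ℝ E]
    [CompleteSpace E] [Fintype ι] (b k : ℕ) {f : ι → ℝ → (Fin l × Fin l → ℝ) → ℝ}
    (hf : ∀ i, ExpGrowth S (f i)) (e : ι → E) {t : ℝ} (ht : t ∈ S) (v : Fin l × Fin l → ℝ) :
    gibbsChain x y p q c β s b k (fun t v => ∑ i, f i t v • e i) t v
      = ∑ i, gibbsChain x y p q c β s b k (f i) t v • e i :=
  hL.tiltChain_sum_smul (fun _ => finiteExpMoments_gaussPi _) (posExpGrowth_gibbsZ β s S) b k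
    (fun i _ => hf i) e ht v

lemma growth_pairSum (r k : ℕ) : ExpGrowth S (pairSum x y p q c β s r k) :=
  have growth_weight (i : Fin l × Fin l) :=
    growth_gibbsChain x y p q c β s hL 1 (k - 1) (posExpGrowth_gibbsWeight β s S i).growth
  .sum fun w _ => .mul (.const S _) <| growth_gibbsChain x y p q c β s hL k r <|
    (growth_weight w.1).mul (growth_weight w.2)

lemma growth_diagSum (r : ℕ) : ExpGrowth S (diagSum x y p q c β s r) :=
  .sum fun i _ => .mul (.const S _) <|
    growth_gibbsChain x y p q c β s hL 1 r (posExpGrowth_gibbsWeight β s S i).growth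

lemma growth_semidiagSum (r : ℕ) : ExpGrowth S (semidiagSum x y p q c β s r) :=
  .sum fun w _ => .mul (.const S _) <| growth_gibbsChain x y p q c β s hL 1 r
    (posExpGrowth_gibbsPairWeight β s S w.1.1 w.1.2 w.2).growth

lemma gibbsChain_kernelForm_gibbsHess (r : ℕ) {t : ℝ} (ht : t ∈ S) (v : Fin l × Fin l → ℝ) :
    gibbsChain x y p q c β s 1 r
        (fun t v => kernelForm (overlapKernel x y p q 0) (gibbsHess β s t v)) t v
      = s * β ^ 2 / 2 * ((1 - p 0) * (1 - q 0) * diagSum x y p q c β s r t v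
        + -(s - 1) * (1 - p 0) * semidiagSum x y p q c β s r t v) := by
  have h_linear := gibbsChain_sum_smul x y p q c β s hL 1 r
    (f := Sum.elim (fun i _ => gibbsWeight β s i)
      (fun (w : (Fin l × Fin l) × Fin l) _ => gibbsPairWeight β s w.1.1 w.1.2 w.2))
    (Sum.rec (fun i => (posExpGrowth_gibbsWeight β s S i).growth)
      fun w => (posExpGrowth_gibbsPairWeight β s S w.1.1 w.1.2 w.2).growth)
    (Sum.elim (fun i => s * β ^ 2 / 2 * ((1 - p 0) * (1 - q 0) * (‖x i.1‖ ^ 2 * ‖y i.2‖ ^ 2)))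
      fun w => s * β ^ 2 / 2 * (-(s - 1) * (1 - p 0) * (‖x w.1.1‖ ^ 2
        * (q 0 * (‖y w.1.2‖ * ‖y w.2‖) - inner ℝ (y w.2) (y w.1.2))))) ht v
  simp only [Fintype.sum_sum_type, Sum.elim_inl, Sum.elim_inr, smul_eq_mul] at h_linear
  simp only [kernelForm_gibbsHess, h_linear, diagSum, semidiagSum, mul_add, Finset.mul_sum]
  congr 1 <;> exact Finset.sum_congr rfl fun _ _ => by ring

lemma gibbsChain_gibbsGrad_single (k : ℕ) {t : ℝ} (ht : t ∈ S) (v : Fin l × Fin l → ℝ)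
    (i : Fin l × Fin l) :
    gibbsChain x y p q c β s 1 k (gibbsGrad β s) t v (Pi.single i 1)
      = gibbsChain x y p q c β s 1 k (fun _ => gibbsWeight β s i) t v * (s * β) := by
  have h_linear := gibbsChain_sum_smul x y p q c β s hL 1 k
    (fun i => (posExpGrowth_gibbsWeight β s S i).growth)
    (fun i => (s * β) • (ContinuousLinearMap.proj i : (Fin l × Fin l → ℝ) →L[ℝ] ℝ)) ht v
  refine (congrArg (fun D : (Fin l × Fin l → ℝ) →L[ℝ] ℝ => D (Pi.single i 1)) h_linear).trans ?_
  simp [sum_apply, Pi.single_apply]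

lemma gibbsChain_overlap {r k : ℕ} {t : ℝ} (ht : t ∈ S) (v : Fin l × Fin l → ℝ) :
    gibbsChain x y p q c β s (k + 1) r (gibbsOverlap x y p q c β s k) t v
      = s * β ^ 2 / 2 * (s * (c k - c (k + 1)) * pairSum x y p q c β s r (k + 1) t v) := by
  let chain (i : Fin l × Fin l) := gibbsChain x y p q c β s 1 k fun _ => gibbsWeight β s i
  have growth_chain (i : Fin l × Fin l) : ExpGrowth S (chain i) :=
    growth_gibbsChain x y p q c β s hL 1 k (posExpGrowth_gibbsWeight β s S i).growth
  let weight (w : (Fin l × Fin l) × (Fin l × Fin l)) : ℝ :=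
    overlapKernel x y p q k w.1 w.2 * ((c k - c (k + 1)) * (s * β) ^ 2)
  have overlap_eq (v : Fin l × Fin l → ℝ) :
      gibbsOverlap x y p q c β s k t v = ∑ w, (chain w.1 t v * chain w.2 t v) • weight w := by
    simp only [gibbsOverlap, overlap, kernelForm_smulRight,
      gibbsChain_gibbsGrad_single x y p q c β s hL k ht v, Finset.mul_sum,
      Fintype.sum_prod_type, smul_eq_mul, chain, weight]
    exact Finset.sum_congr rfl fun i₁ _ => Finset.sum_congr rfl fun i₂ _ =>
      Finset.sum_congr rfl fun p₁ _ => Finset.sum_congr rfl fun p₂ _ => by ring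
  have h_linear := gibbsChain_sum_smul x y p q c β s hL (k + 1) r
    (f := fun w : (Fin l × Fin l) × (Fin l × Fin l) => fun t v => chain w.1 t v * chain w.2 t v)
    (fun w => (growth_chain w.1).mul (growth_chain w.2)) weight ht v
  refine (tiltChain_congr overlap_eq).trans (h_linear.trans ?_)
  rw [pairSum, Nat.add_sub_cancel, Finset.mul_sum, Finset.mul_sum]
  refine Finset.sum_congr rfl fun w _ => ?_
  simp only [smul_eq_mul, weight, chain]
  ring

lemma drift_sub_overlap_gibbs (r : ℕ) {t : ℝ} (ht : t ∈ S) (v : Fin l × Fin l → ℝ) :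
    drift (fun k => gaussPi (layerVar m n p q k)) (layerNoise x y) c (fun _ => gibbsZ β s)
        (fun k => kernelForm (overlapKernel x y p q k)) (gibbsGrad β s)
        (fun t v => kernelForm (overlapKernel x y p q 0) (gibbsHess β s t v)) r t v
      - gibbsOverlap x y p q c β s r t v
      = s * β ^ 2 / 2 * replicaSum x y p q c β s r t v := by
  have pair_term : ∀ b ∈ Finset.Icc 1 (r + 1), gibbsChain x y p q c β s b r
      (gibbsOverlap x y p q c β s (b - 1)) t v
      = s * β ^ 2 / 2 * (s * (c (b - 1) - c b) * pairSum x y p q c β s r b t v) := fun b hb => by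
    obtain ⟨b, rfl⟩ := Nat.exists_eq_add_of_le' (Finset.mem_Icc.1 hb).1
    exact gibbsChain_overlap x y p q c β s hL ht v
  have hess_term := gibbsChain_kernelForm_gibbsHess x y p q c β s hL r ht v
  rw [gibbsChain] at hess_term
  rw [drift_sub_overlap, Finset.sum_congr rfl pair_term, ← Finset.mul_sum, hess_term, replicaSum]
  simp only [neg_mul, Finset.sum_neg_distrib]
  ring

lemma avg_replicaSum {M' : ℝ → (OuterIndex m n → ℝ) →L[ℝ] (Fin l × Fin l → ℝ)}
    (hM : SmoothPath S (outerNoise x y) M') (r : ℕ) {t : ℝ} (ht : t ∈ S) :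
    avg (gaussPi (outerVar m n p q (r + 1))) (outerNoise x y) (replicaSum x y p q c β s r) t 0
      = (∑ k ∈ Finset.Icc 1 (r + 1), φ r x y p q c β s t k)
        + φ₀₁ r x y p q c β s t + φ₀₂ r x y p q c β s t := by
  have h_int {f : ℝ → (Fin l × Fin l → ℝ) → ℝ} (hf : ExpGrowth S f) (a : ℝ) :
      Integrable (fun z => a * f t (0 + outerNoise x y t z))
        (gaussPi (outerVar m n p q (r + 1))) :=
    (hM.integrable (finiteExpMoments_gaussPi _) hf ht 0).const_mul a
  have h_pair (k : ℕ) := h_int (growth_pairSum x y p q c β s hL r k) (-s * (c (k - 1) - c k))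
  have h_diag := h_int (growth_diagSum x y p q c β s hL r) ((1 - p 0) * (1 - q 0))
  have h_semidiag := h_int (growth_semidiagSum x y p q c β s hL r) (-(s - 1) * (1 - p 0))
  have h_pairs := integrable_finsetSum (Finset.Icc 1 (r + 1)) fun k _ => h_pair k
  have φ_sum : ∑ k ∈ Finset.Icc 1 (r + 1), φ r x y p q c β s t k = ∑ k ∈ Finset.Icc 1 (r + 1), _ :=
    Finset.sum_congr rfl fun k hk =>
      φ_eq x y p q c β s (Finset.mem_Icc.1 hk).1 (Finset.mem_Icc.1 hk).2 t
  simp only [avg, replicaSum]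
  rw [integral_add (h_pairs.fun_add h_diag) h_semidiag, integral_add h_pairs h_diag,
    integral_finsetSum _ fun k _ => h_pair k, φ_sum, φ₀₁_eq, φ₀₂_eq]
  simp only [integral_const_mul, avg]

end Replicas

section Derivative

lemma nonneg_of_step_le {u : ℕ → ℝ} {r : ℕ} (hu : ∀ k ≤ r, u (k + 1) ≤ u k)
    (hr : u (r + 1) = 0) {k : ℕ} (hk : k ≤ r + 1) : 0 ≤ u k := by
  induction hk using Nat.decreasingInduction with
  | of_succ k hk ih => exact ih.trans (hu k (by omega))
  | self => exact hr.ge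

lemma exists_mem_Ioo_one_sub {t : ℝ} (ht : t ∈ Set.Ioo (0 : ℝ) 1) :
    ∃ δ, 0 < δ ∧ t ∈ Set.Ioo δ (1 - δ) := by
  have h_pos : 0 < min t (1 - t) := lt_min ht.1 (sub_pos.2 ht.2)
  exact ⟨min t (1 - t) / 2, half_pos h_pos, by linarith [min_le_left t (1 - t)],
    by linarith [min_le_right t (1 - t)]⟩

lemma one_div_mul_abs_mul (β s N : ℝ) :
    1 / (β * |s| * N) * (s * β ^ 2 / 2) = Real.sign s * β / (2 * N) := by
  rcases eq_or_ne s 0 with rfl | hs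
  · simp
  rcases eq_or_ne β 0 with rfl | hβ
  · simp
  have h_sign : Real.sign s = s / |s| := by
    rcases hs.lt_or_gt with h | h
    · rw [Real.sign_of_neg h, abs_of_neg h, div_neg, div_self hs]
    · rw [Real.sign_of_pos h, abs_of_pos h, div_self hs]
  rw [h_sign]
  field_simp

variable {m n l : ℕ} (x : Fin l → EuclideanSpace ℝ (Fin n)) (y : Fin l → EuclideanSpace ℝ (Fin m))
  (p q c : ℕ → ℝ) (β s : ℝ)

lemma ψ_eq (r : ℕ) (t : ℝ) :
    ψ r x y p q c β s t = 1 / (β * |s| * √n)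
      * avg (gaussPi (outerVar m n p q (r + 1))) (outerNoise x y)
          (fun t v => (c r)⁻¹ * Real.log (gibbsTower x y p q c β s r t v)) t 0 := by
  have outer_average := outerExp_tailField x y p q r
    (fun t v => 1 / (β * |s| * √n * c r) * Real.log (gibbsTower x y p q c β s r t v)) t
  simp only [ψ, ζ_eq x y p q c β s le_rfl]
  rw [outer_average]
  simp only [avg, ← integral_const_mul, ← mul_assoc, one_div, mul_inv]

variable {p q c}

theorem hasDerivAt_ψ [NeZero l] {r : ℕ} (hc0 : c 0 = 1) (hc : ∀ k, 1 ≤ k → k ≤ r → c k ≠ 0)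
    (hcr : c (r + 1) = 0) (hp : ∀ k ≤ r, p (k + 1) ≤ p k) (hpr : p (r + 1) = 0)
    (hq : ∀ k ≤ r, q (k + 1) ≤ q k) (hqr : q (r + 1) = 0) {t : ℝ} (ht : t ∈ Set.Ioo (0 : ℝ) 1) :
    HasDerivAt (fun τ => ψ r x y p q c β s τ)
      (Real.sign s * β / (2 * √(n : ℝ)) *
        ((∑ k ∈ Finset.Icc 1 (r + 1), φ r x y p q c β s t k)
          + φ₀₁ r x y p q c β s t + φ₀₂ r x y p q c β s t)) t := by
  obtain ⟨δ, hδ, htδ⟩ := exists_mem_Ioo_one_sub ht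
  have Ioo_subset : ∀ τ ∈ Set.Ioo δ (1 - δ), τ ∈ Set.Ioo (0 : ℝ) 1 := fun τ hτ =>
    ⟨hδ.trans hτ.1, hτ.2.trans (sub_lt_self 1 hδ)⟩
  have hL := smoothPath_layerNoise x y hδ
  have hM := smoothPath_outerNoise x y hδ
  have exponent_ne_zero : ∀ k ≤ r, c k ≠ 0
    | 0, _ => hc0 ▸ one_ne_zero
    | k + 1, hk => hc (k + 1) (by omega) hk
  have log_jet : IsLogJet (Set.Ioo δ (1 - δ)) (c 0) (fun _ => gibbsZ (l := l) β s) (fun _ _ => 0)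
      (gibbsGrad β s) (gibbsHess β s) := by
    rw [hc0]
    exact isLogJet_gibbsZ β s _
  have h_deriv := hL.hasDerivAt_avg_log_tower hM exponent_ne_zero hcr
    (fun k hk τ hτ => covForm_layerNoise x y (hp k hk.le) (hq k hk.le)
      (nonneg_of_step_le hp hpr (by omega)) (nonneg_of_step_le hq hqr (by omega))
      (Ioo_subset τ hτ))
    (fun τ hτ => covForm_outerNoise x y (hp r le_rfl) (hq r le_rfl) hpr hqr (Ioo_subset τ hτ))
    log_jet htδ 0
  simp only [ψ_eq]
  refine (h_deriv.const_mul (1 / (β * |s| * √n))).congr_deriv ?_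
  rw [← avg_replicaSum x y p q c β s hL hM r htδ, ← one_div_mul_abs_mul, mul_assoc (1 / _)]
  congr 1
  simp only [avg, zero_add, drift_sub_overlap_gibbs x y p q c β s hL r htδ, integral_const_mul]

lemma hasDerivAt_ψ_of_isEmpty [IsEmpty (Fin l)] (r : ℕ) (t : ℝ) :
    HasDerivAt (fun τ => ψ r x y p q c β s τ)
      (Real.sign s * β / (2 * √(n : ℝ)) *
        ((∑ k ∈ Finset.Icc 1 (r + 1), φ r x y p q c β s t k)
          + φ₀₁ r x y p q c β s t + φ₀₂ r x y p q c β s t)) t := by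
  have ζ_const (τ : ℝ) (k : ℕ) : ζ r x y p q c β s τ k = ζ r x y p q c β s t k := by
    induction k with
    | zero => funext ω; simp only [ζ, Z, Finset.univ_eq_empty, Finset.sum_empty]
    | succ k ih => simp only [ζ, ih]
  have ψ_const (τ : ℝ) : ψ r x y p q c β s τ = ψ r x y p q c β s t := by simp only [ψ, ζ_const τ]
  simp only [ψ_const]
  exact (hasDerivAt_const t _).congr_deriv (by simp [φ, φ₀₁, φ₀₂, outerExp])

end Derivative

end FullLifting

end

theorem theorem3_general (r m n l : ℕ)
    (x : Fin l → EuclideanSpace ℝ (Fin n)) (y : Fin l → EuclideanSpace ℝ (Fin m))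
    (p q c : ℕ → ℝ)
    (hc0 : c 0 = 1) (hc : ∀ k, 1 ≤ k → k ≤ r → c k ≠ 0) (hcr : c (r + 1) = 0)
    (hp : ∀ k ≤ r, p (k + 1) ≤ p k) (hpr : p (r + 1) = 0)
    (hq : ∀ k ≤ r, q (k + 1) ≤ q k) (hqr : q (r + 1) = 0)
    (β s t : ℝ) (ht : t ∈ Set.Ioo (0 : ℝ) 1) :
    HasDerivAt (fun τ => FullLifting.ψ r x y p q c β s τ)
      (Real.sign s * β / (2 * √(n : ℝ)) *
        ((∑ k ∈ Finset.Icc 1 (r + 1), FullLifting.φ r x y p q c β s t k)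
          + FullLifting.φ₀₁ r x y p q c β s t + FullLifting.φ₀₂ r x y p q c β s t)) t := by
  rcases Nat.eq_zero_or_pos l with rfl | hl
  · exact FullLifting.hasDerivAt_ψ_of_isEmpty x y β s r t
  · have : NeZero l := ⟨hl.ne'⟩
    exact FullLifting.hasDerivAt_ψ x y β s hc0 hc hcr hp hpr hq hqr ht

theorem theorem3 (r : ℕ) (hr : 1 ≤ r) (m n l : ℕ)
    (x : Fin l → EuclideanSpace ℝ (Fin n)) (y : Fin l → EuclideanSpace ℝ (Fin m))
    (p q c : ℕ → ℝ)
    (hc0 : c 0 = 1) (hc : ∀ k, 1 ≤ k → k ≤ r → c k ≠ 0) (hcr : c (r + 1) = 0)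
    (hp0 : p 0 ≤ 1) (hp : ∀ k ≤ r, p (k + 1) ≤ p k) (hpr : p (r + 1) = 0)
    (hq0 : q 0 ≤ 1) (hq : ∀ k ≤ r, q (k + 1) ≤ q k) (hqr : q (r + 1) = 0)
    (β s : ℝ) (hβ : 0 ≤ β) (t : ℝ) (ht : t ∈ Set.Ioo (0 : ℝ) 1) :
    HasDerivAt (fun τ => FullLifting.ψ r x y p q c β s τ)
      (Real.sign s * β / (2 * √(n : ℝ)) *
        ((∑ k ∈ Finset.Icc 1 (r + 1), FullLifting.φ r x y p q c β s t k)
          + FullLifting.φ₀₁ r x y p q c β s t + FullLifting.φ₀₂ r x y p q c β s t)) t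
    ∧ (p 0 = 1 → q 0 = 1 →
      HasDerivAt (fun τ => FullLifting.ψ r x y p q c β s τ)
        (Real.sign s * β / (2 * √(n : ℝ)) *
          ∑ k ∈ Finset.Icc 1 (r + 1), FullLifting.φ r x y p q c β s t k) t) := by
  have main := theorem3_general r m n l x y p q c hc0 hc hcr hp hpr hq hqr β s t ht
  exact ⟨main, fun h h' => by simpa [FullLifting.φ₀₁, FullLifting.φ₀₂, h, h'] using main⟩
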